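/- Graphs are finite and may have parallel edges and loops. A signed graph $(G,\sigma)$ is a graph with a sign $+$ or $-$ on each edge; switching at an edge cut changes the signs of exactly the edges of the cut, and the frustration index $l(G,\sigma)$ is the least number of negative edges over all signatures obtained from $\sigma$ by switching at an edge cut. A cycle is negative if it has an odd number of negative edges. $(G,\sigma)$ is critically $k$-frustrated if $l(G,\sigma)=k$ and $l(G\setminus e,\sigma)=k-1$ for every edge $e$. Subdividing a non-empty set of $t$ parallel edges of the same sign between $x$ and $y$ means replacing them by a new vertex $w$, $t$ positive parallel edges between $x$ and $w$, and $t$ parallel edges of the old sign between $w$ and $y$; $(G,\sigma)$ is irreducible if it does not arise from any signed graph by one or more such subdivisions. Let $\mathcal S^*(k)$ be the family of critically $k$-frustrated signed graphs that are irreducible and contain no two edge-disjoint negative cycles. A canonical embedding of $(G,\sigma)\in\mathcal S^*(k)$ consists of a $2$-connected plane cubic graph $G'$ and a facial circuit $C'$ of $G'$, such that $(G,\sigma)$ is obtained from $G'$, with all edges positive, by inserting $2k$ distinct vertices $z_1,\dots,z_{2k}$ in this cyclic order on the edges of $C'$ (several may lie on one edge; the resulting path edges are positive) and adding the $k$ negative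 edges $z_iz_{k+i}$, $1\le i\le k$, which are drawn through a cross-cap placed in the face bounded by $C'$. This face is called the outer face. Two distinct faces of $G'$ are adjacent if their boundaries share an edge. A boundary face is a face of $G'$ other than the outer face whose boundary shares an edge with $C'$. Lemma. Let $k\ge 4$, let $(G,\sigma)\in\mathcal S^*(k)$, and fix a canonical embedding of $(G,\sigma)$. For any two distinct faces $F_1,F_2$ of $G'$, neither of them the outer face, at most three faces of $G'$ other than the outer face are adjacent to both $F_1$ and $F_2$. Moreover, if $F_1\neq F_2$ are boundary faces that contain two consecutive edges of $C'$ (one each), then at most one face of $G'$ other than the outer face is adjacent to both $F_1$ and $F_2$. -/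

import Mathlib

/-! ## Signed multigraphs -/

/-- A multigraph (parallel edges and loops allowed) with vertex type `V` and edge type `E`. -/
structure Multigraph (V : Type*) (E : Type*) where
  /-- The unordered pair of end vertices of an edge (`s(v, v)` for a loop at `v`). -/
  ends : E → Sym2 V

namespace Multigraph

variable {V E : Type*}

/-- The edge cut `∂(X)`: the edges with one end in `X` and the other end outside `X`. -/
def cut (G : Multigraph V E) (X : Set V) : Set E :=
  {e | ∃ x y, G.ends e = s(x, y) ∧ x ∈ X ∧ y ∉ X}

/-- `u` and `v` are joined by a walk all of whose edges lie in `C`. -/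
def JoinedIn (G : Multigraph V E) (C : Set E) (u v : V) : Prop :=
  Relation.ReflTransGen (fun a b => ∃ e ∈ C, G.ends e = s(a, b)) u v

/-- The graph is non-empty and any two vertices are joined by a walk. -/
def Connected (G : Multigraph V E) : Prop :=
  Nonempty V ∧ ∀ u v, G.JoinedIn Set.univ u v

/-- 2-connectedness of a multigraph: connected, loopless, and still connected after the deletion
of any vertex. -/
def TwoConnected (G : Multigraph V E) : Prop :=
  G.Connected ∧ (∀ e, ¬ (G.ends e).IsDiag) ∧
    ∀ x u v, u ≠ x → v ≠ x → G.JoinedIn {e | x ∉ G.ends e} u v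

/-- The degree of `v` in the subgraph formed by the edge set `C` (a loop counts twice). -/
noncomputable def degreeIn (G : Multigraph V E) (C : Set E) (v : V) : ℕ :=
  {e ∈ C | v ∈ G.ends e}.ncard + {e ∈ C | G.ends e = s(v, v)}.ncard

/-- `C` is the edge set of a cycle, i.e. of a (non-empty) connected 2-regular subgraph. The
vertices of the subgraph are the ends of the edges in `C`. -/
def IsCycle (G : Multigraph V E) (C : Set E) : Prop :=
  C.Nonempty ∧
  (∀ v, (∃ e ∈ C, v ∈ G.ends e) → G.degreeIn C v = 2) ∧
  ∀ u v, (∃ e ∈ C, u ∈ G.ends e) → (∃ e ∈ C, v ∈ G.ends e) → G.JoinedIn C u v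

end Multigraph

/-- A signed graph: a multigraph together with its set of negative edges. -/
structure SignedGraph (V : Type*) (E : Type*) extends Multigraph V E where
  /-- The set of negative edges; the remaining edges are positive. -/
  neg : Set E

namespace SignedGraph

variable {V E V' E' : Type*}

/-- Switching at the edge cut `∂(X)`: the signs of exactly the edges in `∂(X)` are changed. -/
def switch (G : SignedGraph V E) (X : Set V) : SignedGraph V E where
  ends := G.ends
  neg := symmDiff G.neg (G.cut X)

/-- The frustration index: the least number of negative edges of a switching equivalent
signature. -/
noncomputable def frustrationIndex (G : SignedGraph V E) : ℕ :=
  sInf {n | ∃ X : Set V, (G.switch X).neg.ncard = n}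

/-- Deletion of the edge `e`. -/
def deleteEdge (G : SignedGraph V E) (e : E) : SignedGraph V {f : E // f ≠ e} where
  ends f := G.ends f
  neg := {f | (f : E) ∈ G.neg}

/-- Critically `k`-frustrated: the frustration index is `k`, and it drops to `k - 1` on deleting
any edge. -/
def IsCritical (G : SignedGraph V E) (k : ℕ) : Prop :=
  G.frustrationIndex = k ∧ ∀ e, (G.deleteEdge e).frustrationIndex + 1 = k

/-- `C` is the edge set of a negative cycle. -/
def IsNegativeCycle (G : SignedGraph V E) (C : Set E) : Prop :=
  G.IsCycle C ∧ Odd (C ∩ G.neg).ncard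

/-- Isomorphisms of signed graphs. -/
structure Iso (G : SignedGraph V E) (H : SignedGraph V' E') where
  /-- The bijection between the vertices. -/
  onVert : V ≃ V'
  /-- The bijection between the edges. -/
  onEdge : E ≃ E'
  ends_onEdge : ∀ e, H.ends (onEdge e) = (G.ends e).map onVert
  neg_onEdge : ∀ e, onEdge e ∈ H.neg ↔ e ∈ G.neg

open Classical in
/-- Subdividing a set `S` of parallel edges between `x` and `y`, all of the same sign: a new vertex
`w` (here `none`) is added, and `S` is replaced by `|S|` positive edges between `x` and `w` (the
edges `inl e` with `e ∈ S`) and `|S|` edges between `w` and `y` of the old sign (the edges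
`inr e`). -/
noncomputable def subdivide (G : SignedGraph V E) (x y : V) (S : Set E) :
    SignedGraph (Option V) (E ⊕ S) where
  ends
    | .inl e => if e ∈ S then s(some x, none) else (G.ends e).map some
    | .inr _ => s(none, some y)
  neg := {f | (∃ e, f = .inl e ∧ e ∉ S ∧ e ∈ G.neg) ∨ ∃ e : S, f = .inr e ∧ (e : E) ∈ G.neg}

/-- `IsProperSubdivision H G`: `G` is obtained (up to isomorphism) from `H` by sequentially
subdividing sets of parallel edges of equal sign, in at least one step. -/
inductive IsProperSubdivision.{u, v} : ∀ {V : Type u} {E : Type v} {V' : Type u} {E' : Type v},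
    SignedGraph V E → SignedGraph V' E' → Prop
  | single {V : Type u} {E : Type v} {V' : Type u} {E' : Type v}
      (H : SignedGraph V E) (G : SignedGraph V' E') (x y : V) (S : Set E)
      (hfin : S.Finite) (hne : S.Nonempty) (hpar : ∀ e ∈ S, H.ends e = s(x, y))
      (hsign : S ⊆ H.neg ∨ Disjoint S H.neg)
      (hiso : Nonempty (Iso (H.subdivide x y S) G)) : IsProperSubdivision H G
  | trans {V : Type u} {E : Type v} {V' : Type u} {E' : Type v} {V'' : Type u} {E'' : Type v}
      (H : SignedGraph V E) (K : SignedGraph V' E') (G : SignedGraph V'' E'')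
      (h₁ : IsProperSubdivision H K) (h₂ : IsProperSubdivision K G) : IsProperSubdivision H G

/-- A signed graph is irreducible if it is not a proper subdivision of any signed graph. -/
def IsIrreducible.{u, v} {V : Type u} {E : Type v} (G : SignedGraph V E) : Prop :=
  ∀ (V₀ : Type u) (E₀ : Type v) (H : SignedGraph V₀ E₀), ¬ IsProperSubdivision H G

/-- The family `S*(k)` of prime critically `k`-frustrated signed graphs: critically `k`-frustrated,
irreducible, and without two edge-disjoint negative cycles. -/
def IsPrimeCritical (G : SignedGraph V E) (k : ℕ) : Prop :=
  G.IsCritical k ∧ G.IsIrreducible ∧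
    ¬ ∃ C₁ C₂ : Set E, G.IsNegativeCycle C₁ ∧ G.IsNegativeCycle C₂ ∧ Disjoint C₁ C₂

end SignedGraph

/-! ## Plane graphs as combinatorial maps -/

/-- A combinatorial map (rotation system) on a set `D` of darts (half-edges). A dart is an edge
together with a direction, and it belongs to the vertex from which it starts. -/
structure CombMap (D : Type*) where
  /-- The rotation: the next dart around the vertex from which a dart starts. -/
  rot : Equiv.Perm D
  /-- The same edge with the opposite direction. -/
  rev : Equiv.Perm D
  rev_rev : ∀ d, rev (rev d) = d
  rev_ne : ∀ d, rev d ≠ d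

namespace CombMap

variable {D : Type*}

/-- The dart following `d` on the boundary walk of the face that lies along `d`. -/
def next (M : CombMap D) : Equiv.Perm D := M.rot * M.rev

/-- The vertices are the orbits of the rotation. -/
def Vertex (M : CombMap D) : Type _ := Quotient (Equiv.Perm.SameCycle.setoid M.rot)

/-- Two darts carry the same edge. -/
def edgeSetoid (M : CombMap D) : Setoid D where
  r d d' := d' = d ∨ d' = M.rev d
  iseqv := by
    refine ⟨fun d => Or.inl rfl, ?_, ?_⟩
    · rintro d d' (rfl | rfl)
      · exact Or.inl rfl
      · exact Or.inr (M.rev_rev d).symm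
    · rintro d d' d'' (rfl | rfl) (rfl | rfl)
      · exact Or.inl rfl
      · exact Or.inr rfl
      · exact Or.inr rfl
      · exact Or.inl (M.rev_rev d)

/-- The edges are the orbits `{d, rev d}`. -/
def Edge (M : CombMap D) : Type _ := Quotient M.edgeSetoid

/-- The faces are the orbits of `next`. -/
def Face (M : CombMap D) : Type _ := Quotient (Equiv.Perm.SameCycle.setoid M.next)

/-- The vertex from which the dart `d` starts. -/
def vertexOf (M : CombMap D) (d : D) : M.Vertex := Quotient.mk _ d

/-- The edge carrying the dart `d`. -/
def edgeOf (M : CombMap D) (d : D) : M.Edge := Quotient.mk _ d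

/-- The face along the dart `d`; the face on the other side of this edge is
`M.faceOf (M.rev d)`. -/
def faceOf (M : CombMap D) (d : D) : M.Face := Quotient.mk _ d

/-- The underlying multigraph of a combinatorial map. -/
def graph (M : CombMap D) : Multigraph M.Vertex M.Edge where
  ends := Quotient.lift (fun d => s(M.vertexOf d, M.vertexOf (M.rev d))) (by
    rintro d d' (rfl | rfl)
    · rfl
    · show s(_, _) = s(_, _)
      rw [M.rev_rev]
      exact Sym2.eq_swap)

/-- The map is a plane (equivalently, spherical) embedding of a connected graph: Euler's formula
`|V| - |E| + |F| = 2` holds. -/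
def IsPlane (M : CombMap D) : Prop :=
  M.graph.Connected ∧ Nat.card M.Vertex + Nat.card M.Face = Nat.card M.Edge + 2

/-- Every vertex has degree three: every orbit of the rotation has exactly three elements. -/
def IsCubic (M : CombMap D) : Prop :=
  ∀ d, M.rot d ≠ d ∧ M.rot (M.rot (M.rot d)) = d

/-- Two (distinct) faces are adjacent if their boundaries share an edge. -/
def FaceAdj (M : CombMap D) (F F' : M.Face) : Prop :=
  F ≠ F' ∧ ∃ d, M.faceOf d = F ∧ M.faceOf (M.rev d) = F'

end CombMap

/-! ## Canonical embeddings -/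

/-- The data of a canonical embedding: a 2-connected plane cubic graph `G'`, a facial circuit `C'`
of it, and a distribution of `2k` new vertices over the edges of `C'`. -/
structure CanonicalData (D : Type*) (k : ℕ) where
  /-- The plane graph `G'`. -/
  map : CombMap D
  isPlane : map.IsPlane
  isCubic : map.IsCubic
  twoConnected : map.graph.TwoConnected
  /-- A dart on the selected facial circuit `C'`; the edges of `C'` are listed starting from it. -/
  base : D
  /-- The number of new vertices on the `j`-th edge of `C'`. -/
  weight : Fin (Function.minimalPeriod map.next base) → ℕ
  sum_weight : ∑ j, weight j = 2 * k

namespace CanonicalData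

variable {D : Type*} {k : ℕ}

/-- The face of `G'` bounded by the selected facial circuit `C'` (it receives the cross-cap). -/
def outer (c : CanonicalData D k) : c.map.Face := c.map.faceOf c.base

/-- The number of edges of `C'`. -/
noncomputable abbrev len (c : CanonicalData D k) : ℕ := Function.minimalPeriod c.map.next c.base

/-- The `j`-th dart along `C'`. -/
def border (c : CanonicalData D k) (j : Fin c.len) : D := c.map.next^[j] c.base

/-- The vertices of `G`: those of `G'`, and the `weight j` new vertices on the `j`-th edge
of `C'`. -/
abbrev Vert (c : CanonicalData D k) : Type _ :=
  c.map.Vertex ⊕ (Σ j : Fin c.len, Fin (c.weight j))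

/-- The edges of `G`: the edges of `G'` that are not on `C'`, the `weight j + 1` edges of the path
that replaces the `j`-th edge of `C'`, and the `k` edges through the cross-cap. -/
abbrev Edg (c : CanonicalData D k) : Type _ :=
  {e : c.map.Edge // ∀ d, c.map.edgeOf d = e → c.map.faceOf d ≠ c.outer} ⊕
    (Σ j : Fin c.len, Fin (c.weight j + 1)) ⊕ Fin k

/-- The `s`-th vertex (`0 ≤ s ≤ weight j + 1`) on the path that replaces the `j`-th edge of `C'`,
which runs from the start of this edge through the new vertices to its end. -/
def pathVert (c : CanonicalData D k) (j : Fin c.len) (s : ℕ) : c.Vert :=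
  if s = 0 then .inl (c.map.vertexOf (c.border j))
  else if h : s - 1 < c.weight j then .inr ⟨j, ⟨s - 1, h⟩⟩
  else .inl (c.map.vertexOf (c.map.rev (c.border j)))

/-- The `2k` new vertices `z_0, …, z_{2k-1}` in the cyclic order in which they occur on `C`
(edge by edge, and along each edge). -/
noncomputable def z (c : CanonicalData D k) (i : Fin (2 * k)) : c.Vert :=
  .inr (finSigmaFinEquiv.symm (Fin.cast c.sum_weight.symm i))

/-- The signed graph obtained from `G'` by inserting the new vertices on `C'` and adding the `k`
negative edges `z_i z_{k+i}`; all other edges are positive. -/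
noncomputable def signedGraph (c : CanonicalData D k) : SignedGraph c.Vert c.Edg where
  ends
    | .inl e => (c.map.graph.ends e).map .inl
    | .inr (.inl ⟨j, s⟩) => s(c.pathVert j s, c.pathVert j (s + 1))
    | .inr (.inr i) => s(c.z ⟨i, by omega⟩, c.z ⟨k + i, by omega⟩)
  neg := {f | ∃ i : Fin k, f = .inr (.inr i)}

/-- `F` is a boundary face of `G'`: a face other than the outer one whose boundary shares an edge
with `C'`. -/
def IsBoundaryFace (c : CanonicalData D k) (F : c.map.Face) : Prop :=
  F ≠ c.outer ∧ ∃ d, c.map.faceOf d = c.outer ∧ c.map.faceOf (c.map.rev d) = F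

/-- `F₁` and `F₂` have edges on `C'` (those of the outer darts `d₁` and `d₂`) that are consecutive
on `C'`. -/
def HaveConsecutiveEdges (c : CanonicalData D k) (F₁ F₂ : c.map.Face) : Prop :=
  ∃ d₁ d₂, c.map.faceOf d₁ = c.outer ∧ c.map.faceOf d₂ = c.outer ∧
    c.map.faceOf (c.map.rev d₁) = F₁ ∧ c.map.faceOf (c.map.rev d₂) = F₂ ∧
    (c.map.next d₁ = d₂ ∨ c.map.next d₂ = d₁)

/-- The faces of `G'`, other than the outer one, that are adjacent to both `F₁` and `F₂`. -/
def commonAdjFaces (c : CanonicalData D k) (F₁ F₂ : c.map.Face) : Set c.map.Face :=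
  {H | H ≠ c.outer ∧ c.map.FaceAdj H F₁ ∧ c.map.FaceAdj H F₂}

end CanonicalData

/-- A canonical embedding of the signed graph `G` on the projective plane: an identification of `G`
with the signed graph built from a plane graph `G'`, with the negative edges embedded in a cross-cap
inside the selected face of `G'`. -/
structure CanonicalEmbedding (D : Type*) {V E : Type*} (G : SignedGraph V E) (k : ℕ)
    extends CanonicalData D k where
  /-- The identification of the constructed signed graph with `G`. -/
  iso : SignedGraph.Iso toCanonicalData.signedGraph G

/-! Criticality enters only through tight cuts. A signature that is optimal after deleting a
positive edge `e` must make `e` negative, so `e` lies in a cut whose switching attains the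
frustration index (`IsCritical.isCoveredByTightCuts`). Let `X` be a set of vertices off `C'` and
take a tight cut through an edge at `X`. Placing all of `X` on either side of this cut cannot lower
the number of negative edges. Hence the set `A` of cut edges at `X` can be exchanged for a set `B ⊆
cut X` or for `cut X \ B`, neither smaller than `A`, and `A` and `B` meet every face with the same
parity (`IsInner.exists_trace`). In particular `2|A| ≤ |cut X|`.

By plane duality over `ZMod 2`, a closed walk in the dual that avoids the outer face yields such an
`X` (`exists_isInner_cut_eq`). Short dual cycles are therefore very restricted. Dual loops do not
occur, two inner faces share at most one edge (`dart_unique`), and a dual triangle has no further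
face at a vertex inside it. The last fact gives the statement on consecutive edges: the edge of `G'`
leaving `C'` between `F₁` and `F₂` closes a dual triangle with any common neighbour, which must then
be the third face at the other end of that edge.

For the bound three, two common neighbours `H`, `H'` span a dual 4-cycle `F₁ H F₂ H'` with a region
inside. Given four common neighbours, choose the pair `H`, `H'` with the largest region; the other
common neighbours `L`, `L'` lie inside it. As `L'` separates `L` from `H` or from `H'`, the face `L`
cannot touch both. The parity argument for cuts of size four (`IsInner.faceOf_rot_rot_eq`) then
shows that `F₁`, `L`, `F₂` meet at a prescribed end of the edge between `F₁` and `L`. The same holds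
for `L'`, so both produce the unique edge between `F₁` and `F₂` with the same orientation, which
forces `L = L'`. -/

theorem Equiv.Perm.SameCycle.apply_eq_of_invariant {α β : Type*} {σ : Equiv.Perm α} {f : α → β}
    (hf : ∀ a, f (σ a) = f a) {a b : α} (h : σ.SameCycle a b) : f a = f b := by
  obtain ⟨i, rfl⟩ := h
  induction i with
  | zero => simp
  | succ i ih => rw [ih, add_comm, zpow_add, zpow_one, Equiv.Perm.mul_apply, hf]
  | pred i ih =>
    rw [ih, ← hf ((σ ^ (-(i : ℤ) - 1)) a), ← Equiv.Perm.mul_apply, ← zpow_one_add]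
    congr 3
    ring

/-! ### Combinatorial maps and plane duality over `ZMod 2` -/

namespace CombMap

variable {D : Type*} (M : CombMap D)

theorem vertexOf_rot (d : D) : M.vertexOf (M.rot d) = M.vertexOf d :=
  Quotient.sound (s := Equiv.Perm.SameCycle.setoid M.rot) ⟨-1, by simp⟩

theorem faceOf_next (d : D) : M.faceOf (M.next d) = M.faceOf d :=
  Quotient.sound (s := Equiv.Perm.SameCycle.setoid M.next) ⟨-1, by simp⟩

theorem next_apply (d : D) : M.next d = M.rot (M.rev d) := rfl

theorem next_rev (d : D) : M.next (M.rev d) = M.rot d := by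
  rw [next_apply, M.rev_rev]

theorem faceOf_rot (d : D) : M.faceOf (M.rot d) = M.faceOf (M.rev d) := by
  rw [← M.next_rev, faceOf_next]

theorem vertexOf_next (d : D) : M.vertexOf (M.next d) = M.vertexOf (M.rev d) :=
  M.vertexOf_rot _

theorem edgeOf_eq_edgeOf {d d' : D} : M.edgeOf d = M.edgeOf d' ↔ d' = d ∨ d' = M.rev d :=
  ⟨fun h => Quotient.exact (s := M.edgeSetoid) h, fun h => Quotient.sound (s := M.edgeSetoid) h⟩

theorem edgeOf_rev (d : D) : M.edgeOf (M.rev d) = M.edgeOf d :=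
  (M.edgeOf_eq_edgeOf.2 (Or.inr rfl)).symm

theorem exists_edgeOf_eq (e : M.Edge) : ∃ d, M.edgeOf d = e := Quotient.exists_rep e

theorem exists_vertexOf_eq (v : M.Vertex) : ∃ d, M.vertexOf d = v := Quotient.exists_rep v

theorem exists_faceOf_eq (F : M.Face) : ∃ d, M.faceOf d = F := Quotient.exists_rep F

theorem ends_edgeOf (d : D) :
    M.graph.ends (M.edgeOf d) = s(M.vertexOf d, M.vertexOf (M.rev d)) := rfl

theorem eq_of_faceOf_eq {β : Type*} {f : D → β} (hf : ∀ d, f (M.next d) = f d) {d d' : D}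
    (h : M.faceOf d = M.faceOf d') : f d = f d' :=
  Equiv.Perm.SameCycle.apply_eq_of_invariant hf
    (Quotient.exact (s := Equiv.Perm.SameCycle.setoid M.next) h)

theorem eq_of_vertexOf_eq {β : Type*} {f : D → β} (hf : ∀ d, f (M.rot d) = f d) {d d' : D}
    (h : M.vertexOf d = M.vertexOf d') : f d = f d' :=
  Equiv.Perm.SameCycle.apply_eq_of_invariant hf
    (Quotient.exact (s := Equiv.Perm.SameCycle.setoid M.rot) h)

variable {M}

/-- On a connected map, a function of darts that is invariant under rotation and reversal is
constant. -/
theorem eq_of_invariant (hM : M.graph.Connected) {β : Type*} {f : D → β}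
    (hrot : ∀ d, f (M.rot d) = f d) (hrev : ∀ d, f (M.rev d) = f d) (d d' : D) : f d = f d' := by
  suffices h : ∀ v, M.graph.JoinedIn Set.univ (M.vertexOf d) v → ∀ c, M.vertexOf c = v →
      f d = f c from h _ (hM.2 _ _) d' rfl
  intro v hv
  induction hv with
  | refl => exact fun c hc => M.eq_of_vertexOf_eq hrot hc.symm
  | tail _ he ih =>
    rintro c rfl
    obtain ⟨e, -, he⟩ := he
    obtain ⟨b, rfl⟩ := M.exists_edgeOf_eq e
    rw [ends_edgeOf, Sym2.eq_iff] at he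
    rcases he with ⟨h1, h2⟩ | ⟨h1, h2⟩
    · rw [ih b h1, ← hrev b]
      exact M.eq_of_vertexOf_eq hrot h2
    · rw [ih (M.rev b) h2, hrev b]
      exact M.eq_of_vertexOf_eq hrot h1

theorem edgeOf_mem_cut {X : Set M.Vertex} {d : D} :
    M.edgeOf d ∈ M.graph.cut X ↔ ¬ (M.vertexOf d ∈ X ↔ M.vertexOf (M.rev d) ∈ X) := by
  constructor
  · rintro ⟨x, y, h, hx, hy⟩
    rw [ends_edgeOf, Sym2.eq_iff] at h
    rcases h with ⟨rfl, rfl⟩ | ⟨rfl, rfl⟩ <;> tauto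
  · intro h
    by_cases hd : M.vertexOf d ∈ X
    · exact ⟨_, _, M.ends_edgeOf d, hd, by tauto⟩
    · exact ⟨_, _, (M.ends_edgeOf d).trans Sym2.eq_swap, by tauto, hd⟩

instance [Finite D] : Finite M.Vertex := Quotient.finite _
instance [Finite D] : Finite M.Edge := Quotient.finite _
instance [Finite D] : Finite M.Face := Quotient.finite _
noncomputable instance [Finite D] : Fintype M.Vertex := Fintype.ofFinite _
noncomputable instance [Finite D] : Fintype M.Edge := Fintype.ofFinite _
noncomputable instance [Finite D] : Fintype M.Face := Fintype.ofFinite _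

variable (M)

open Classical in
/-- The number of sides, modulo 2, of the edge `e` that belong to the face `F`. -/
noncomputable def incidence (F : M.Face) : M.Edge → ZMod 2 :=
  Quotient.lift
    (fun d => (if M.faceOf d = F then 1 else 0) + (if M.faceOf (M.rev d) = F then 1 else 0)) (by
      rintro d d' (rfl | rfl)
      · rfl
      · simp only [M.rev_rev]
        exact add_comm _ _)

open Classical in
theorem incidence_edgeOf (F : M.Face) (d : D) : M.incidence F (M.edgeOf d) =
    (if M.faceOf d = F then 1 else 0) + (if M.faceOf (M.rev d) = F then 1 else 0) := rfl

/-- The coboundary of a function on the vertices, modulo 2. -/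
def coboundary : (M.Vertex → ZMod 2) →ₗ[ZMod 2] (M.Edge → ZMod 2) where
  toFun x := Quotient.lift (fun d => x (M.vertexOf d) + x (M.vertexOf (M.rev d))) (by
    rintro d d' (rfl | rfl)
    · rfl
    · simp only [M.rev_rev]
      exact add_comm _ _)
  map_add' x y := by
    funext e
    induction e using Quotient.inductionOn
    exact add_add_add_comm _ _ _ _
  map_smul' r x := by
    funext e
    induction e using Quotient.inductionOn
    exact (mul_add _ _ _).symm

theorem coboundary_edgeOf (x : M.Vertex → ZMod 2) (d : D) :
    M.coboundary x (M.edgeOf d) = x (M.vertexOf d) + x (M.vertexOf (M.rev d)) := rfl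

variable [Finite D]

/-- The degree of `F`, modulo 2, in the set of edges with indicator function `s`. -/
noncomputable def faceDegree (s : M.Edge → ZMod 2) (F : M.Face) : ZMod 2 :=
  ∑ e, M.incidence F e * s e

-- Each edge consists of two darts, one per side. The sum over darts follows the boundary walk of
-- the face, along which a coboundary cancels.
open Classical in
theorem faceDegree_eq_sum_darts [Fintype D] (s : M.Edge → ZMod 2) (F : M.Face) :
    M.faceDegree s F = ∑ d with M.faceOf d = F, s (M.edgeOf d) := by
  have key : ∀ g : D → ZMod 2, ∑ d, g d = ∑ e : M.Edge, (g e.out + g (M.rev e.out)) := by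
    intro g
    rw [← Finset.sum_fiberwise (s := Finset.univ) (g := M.edgeOf) (f := g)]
    refine Finset.sum_congr rfl fun e _ => ?_
    have : Finset.univ.filter (fun d => M.edgeOf d = e) = {e.out, M.rev e.out} := by
      ext d
      have he : M.edgeOf e.out = e := Quotient.out_eq e
      rw [Finset.mem_filter, Finset.mem_insert, Finset.mem_singleton]
      nth_rewrite 1 [← he]
      rw [eq_comm, edgeOf_eq_edgeOf]
      simp
    rw [this, Finset.sum_pair (M.rev_ne _).symm]
  rw [Finset.sum_filter, key, faceDegree]
  refine Finset.sum_congr rfl fun e _ => ?_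
  have he : M.edgeOf e.out = e := Quotient.out_eq e
  rw [M.edgeOf_rev, he]
  nth_rewrite 1 [← he]
  rw [incidence_edgeOf, add_mul]
  simp

theorem faceDegree_coboundary (x : M.Vertex → ZMod 2) (F : M.Face) :
    M.faceDegree (M.coboundary x) F = 0 := by
  classical
  have := Fintype.ofFinite D
  rw [faceDegree_eq_sum_darts]
  simp only [coboundary_edgeOf, ← vertexOf_next]
  rw [Finset.sum_add_distrib]
  -- `next` permutes the darts of a face, so each start vertex is counted twice in total.
  have : ∑ d with M.faceOf d = F, x (M.vertexOf (M.next d)) =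
      ∑ d with M.faceOf d = F, x (M.vertexOf d) :=
    Finset.sum_equiv M.next (by simp [faceOf_next]) (by simp)
  rw [this, CharTwo.add_self_eq_zero]

variable {M}

/-- In a plane map, a set of edges meeting every face boundary evenly is an edge cut. -/
theorem IsPlane.exists_coboundary_eq (hM : M.IsPlane) {s : M.Edge → ZMod 2}
    (hs : ∀ F, M.faceDegree s F = 0) : ∃ x, M.coboundary x = s := by
  classical
  obtain ⟨hc, hE⟩ := hM
  let N : Matrix M.Face M.Edge (ZMod 2) := Matrix.of M.incidence
  have hker : ∀ t, t ∈ LinearMap.ker N.mulVecLin ↔ ∀ F, M.faceDegree t F = 0 := fun t => by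
    rw [LinearMap.mem_ker, funext_iff]
    rfl
  have hle : LinearMap.range M.coboundary ≤ LinearMap.ker N.mulVecLin := by
    rintro _ ⟨x, rfl⟩
    exact (hker _).2 (M.faceDegree_coboundary x)
  have hN : ∀ y d, N.transpose.mulVec y (M.edgeOf d) = y (M.faceOf d) + y (M.faceOf (M.rev d)) := by
    intro y d
    simp [N, Matrix.mulVec, dotProduct, incidence_edgeOf, add_mul, Finset.sum_add_distrib]
  have two : ∀ a b : ZMod 2, a + b = 0 → b = a := by decide
  -- By connectedness only constant functions have zero coboundary.
  have hV : Module.finrank (ZMod 2) (LinearMap.ker M.coboundary) ≤ 1 := by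
    refine finrank_le_one ⟨fun _ => 1, ?_⟩ ?_
    · rw [LinearMap.mem_ker]
      funext e
      obtain ⟨d, rfl⟩ := M.exists_edgeOf_eq e
      rw [coboundary_edgeOf]
      rfl
    · rintro ⟨x, hx⟩
      rw [LinearMap.mem_ker] at hx
      obtain ⟨v⟩ := hc.1
      refine ⟨x v, Subtype.ext (funext fun w => ?_)⟩
      obtain ⟨d, rfl⟩ := M.exists_vertexOf_eq v
      obtain ⟨d', rfl⟩ := M.exists_vertexOf_eq w
      simpa using eq_of_invariant hc (f := fun d => x (M.vertexOf d))
        (fun d => by rw [vertexOf_rot]) (fun d => two _ _ (congrFun hx (M.edgeOf d))) d d'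
  -- Dually, a function on the faces that agrees across every edge is constant.
  have hF : Module.finrank (ZMod 2) (LinearMap.ker N.transpose.mulVecLin) ≤ 1 := by
    have hrev : ∀ y ∈ LinearMap.ker N.transpose.mulVecLin, ∀ d,
        y (M.faceOf (M.rev d)) = y (M.faceOf d) := fun y hy d => by
      rw [LinearMap.mem_ker] at hy
      exact two _ _ ((hN y d).symm.trans (congrFun hy _))
    refine finrank_le_one ⟨fun _ => 1, ?_⟩ ?_
    · rw [LinearMap.mem_ker]
      funext e
      obtain ⟨d, rfl⟩ := M.exists_edgeOf_eq e
      exact (hN _ d).trans rfl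
    · rintro ⟨y, hy⟩
      obtain ⟨v⟩ := hc.1
      obtain ⟨d, rfl⟩ := M.exists_vertexOf_eq v
      refine ⟨y (M.faceOf d), Subtype.ext (funext fun F => ?_)⟩
      obtain ⟨d', rfl⟩ := M.exists_faceOf_eq F
      simpa using eq_of_invariant hc (f := fun d => y (M.faceOf d))
        (fun d => by rw [faceOf_rot, hrev y hy]) (hrev y hy) d d'
  have e1 := LinearMap.finrank_range_add_finrank_ker M.coboundary
  have e2 := LinearMap.finrank_range_add_finrank_ker N.mulVecLin
  have e3 := LinearMap.finrank_range_add_finrank_ker N.transpose.mulVecLin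
  have e4 : Module.finrank (ZMod 2) (LinearMap.range N.transpose.mulVecLin) =
      Module.finrank (ZMod 2) (LinearMap.range N.mulVecLin) := N.rank_transpose
  rw [Module.finrank_fintype_fun_eq_card, ← Nat.card_eq_fintype_card] at e1 e2 e3
  -- The coboundaries have dimension at least `|V| - 1`. The rank of `N` is at least `|F| - 1`, so
  -- its kernel has dimension at most `|E| - |F| + 1`, which is `|V| - 1` by Euler's formula.
  have heq := Submodule.eq_of_le_of_finrank_le hle (by omega)
  have : s ∈ LinearMap.range M.coboundary := heq ▸ (hker s).2 hs
  exact this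

end CombMap

theorem Multigraph.mem_cut_congr {V E : Type*} {G : Multigraph V E} {X Y : Set V} {e : E}
    (h : ∀ x ∈ G.ends e, x ∈ X ↔ x ∈ Y) : e ∈ G.cut X ↔ e ∈ G.cut Y := by
  have : ∀ {X Y : Set V}, (∀ x ∈ G.ends e, x ∈ X ↔ x ∈ Y) → e ∈ G.cut X → e ∈ G.cut Y := by
    rintro X Y h ⟨x, y, he, hx, hy⟩
    exact ⟨x, y, he, (h x (by simp [he])).1 hx, fun hy' => hy ((h y (by simp [he])).2 hy')⟩
  exact ⟨this h, this fun x hx => (h x hx).symm⟩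

/-! ### Criticality and tight cuts -/

namespace SignedGraph

variable {V E V' E' : Type*}

/-- Every positive edge lies in an edge cut whose switching keeps the number of negative edges at
its minimum. -/
def IsCoveredByTightCuts (G : SignedGraph V E) : Prop :=
  ∃ n, (∀ X, n ≤ (G.switch X).neg.ncard) ∧
    ∀ e ∉ G.neg, ∃ X, e ∈ G.cut X ∧ (G.switch X).neg.ncard = n

theorem IsCritical.isCoveredByTightCuts [Finite E] {G : SignedGraph V E} {k : ℕ}
    (hG : G.IsCritical k) : G.IsCoveredByTightCuts := by
  have hmin : ∀ X, k ≤ (G.switch X).neg.ncard := fun X => hG.1 ▸ Nat.sInf_le ⟨X, rfl⟩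
  refine ⟨k, hmin, fun e he => ?_⟩
  obtain ⟨X, hX⟩ : ∃ X, ((G.deleteEdge e).switch X).neg.ncard =
      (G.deleteEdge e).frustrationIndex :=
    Nat.sInf_mem (s := {n | ∃ X, ((G.deleteEdge e).switch X).neg.ncard = n}) ⟨_, ∅, rfl⟩
  have himg : Subtype.val '' ((G.deleteEdge e).switch X).neg = (G.switch X).neg \ {e} := by
    ext f
    constructor
    · rintro ⟨f, hf, rfl⟩
      exact ⟨hf, f.2⟩
    · rintro ⟨hf, hfe⟩
      exact ⟨⟨f, hfe⟩, hf, rfl⟩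
  have hcard := congrArg Set.ncard himg
  rw [Set.ncard_image_of_injective _ Subtype.val_injective, hX] at hcard
  have hk := hG.2 e
  -- Otherwise switching at `X` would leave only `k - 1` negative edges in `G` itself.
  have hmem : e ∈ (G.switch X).neg := by
    by_contra h
    rw [Set.sdiff_singleton_eq_self h] at hcard
    have := hmin X
    omega
  refine ⟨X, ?_, ?_⟩
  · rcases hmem with h | h
    · exact absurd h.1 he
    · exact h.1
  · rw [← Set.ncard_sdiff_singleton_add_one hmem (Set.toFinite _), ← hcard, hk]

theorem Iso.mem_cut_preimage {G : SignedGraph V E} {H : SignedGraph V' E'} (φ : Iso G H)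
    (X : Set V') (e : E) : e ∈ G.cut (φ.onVert ⁻¹' X) ↔ φ.onEdge e ∈ H.cut X := by
  constructor
  · rintro ⟨x, y, h, hx, hy⟩
    exact ⟨φ.onVert x, φ.onVert y, by simp [φ.ends_onEdge, h], hx, hy⟩
  · rintro ⟨x, y, h, hx, hy⟩
    refine ⟨φ.onVert.symm x, φ.onVert.symm y, ?_, by simpa, by simpa⟩
    apply Sym2.map.injective φ.onVert.injective
    simp [← φ.ends_onEdge, h]

theorem Iso.ncard_switch_preimage {G : SignedGraph V E} {H : SignedGraph V' E'} (φ : Iso G H)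
    (X : Set V') : (G.switch (φ.onVert ⁻¹' X)).neg.ncard = (H.switch X).neg.ncard := by
  refine Set.ncard_congr' (φ.onEdge.subtypeEquiv fun e => ?_)
  show e ∈ symmDiff _ _ ↔ φ.onEdge e ∈ symmDiff _ _
  rw [Set.mem_symmDiff, Set.mem_symmDiff, φ.mem_cut_preimage, φ.neg_onEdge]

theorem Iso.isCoveredByTightCuts {G : SignedGraph V E} {H : SignedGraph V' E'} (φ : Iso G H)
    (hH : H.IsCoveredByTightCuts) : G.IsCoveredByTightCuts := by
  obtain ⟨n, hmin, htight⟩ := hH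
  refine ⟨n, fun X => ?_, fun e he => ?_⟩
  · have := φ.ncard_switch_preimage (φ.onVert '' X)
    rw [Set.preimage_image_eq _ φ.onVert.injective] at this
    exact this ▸ hmin _
  · obtain ⟨X, hX, hn⟩ := htight (φ.onEdge e) (by rwa [φ.neg_onEdge])
    exact ⟨_, (φ.mem_cut_preimage X e).2 hX, (φ.ncard_switch_preimage X).trans hn⟩

end SignedGraph

/-! ### Exchanging edges of a tight cut at a set of vertices off `C'` -/

namespace CombMap

variable {D : Type*} {M : CombMap D}

/-- The edges with at least one end in `X`. -/
def edgesAt (M : CombMap D) (X : Set M.Vertex) : Set M.Edge :=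
  {e | ∃ d, M.edgeOf d = e ∧ M.vertexOf d ∈ X}

theorem coboundary_indicator (U : Set M.Vertex) :
    M.coboundary (U.indicator 1) = (M.graph.cut U).indicator 1 := by
  classical
  funext e
  obtain ⟨d, rfl⟩ := M.exists_edgeOf_eq e
  rw [coboundary_edgeOf]
  simp only [Set.indicator_apply, edgeOf_mem_cut, Pi.one_apply]
  by_cases h1 : M.vertexOf d ∈ U <;> by_cases h2 : M.vertexOf (M.rev d) ∈ U <;> simp [h1, h2]
  decide

theorem faceDegree_add [Finite D] (s t : M.Edge → ZMod 2) (F : M.Face) :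
    M.faceDegree (s + t) F = M.faceDegree s F + M.faceDegree t F := by
  simp [faceDegree, mul_add, Finset.sum_add_distrib]

theorem faceDegree_cut [Finite D] (U : Set M.Vertex) (F : M.Face) :
    M.faceDegree ((M.graph.cut U).indicator 1) F = 0 := by
  rw [← coboundary_indicator, faceDegree_coboundary]

end CombMap

namespace CanonicalData

variable {D : Type*} {k : ℕ} {c : CanonicalData D k}

/-- No vertex of `X` lies on the facial circuit `C'`. -/
def IsInner (c : CanonicalData D k) (X : Set c.map.Vertex) : Prop :=
  ∀ d, c.map.faceOf d = c.outer → c.map.vertexOf d ∉ X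

theorem IsInner.faceOf_ne {X : Set c.map.Vertex} (hX : c.IsInner X) {d : D}
    (hd : c.map.vertexOf d ∈ X) : c.map.faceOf d ≠ c.outer :=
  fun h => hX d h hd

theorem faceOf_border (c : CanonicalData D k) (j : Fin c.len) :
    c.map.faceOf (c.border j) = c.outer := by
  unfold border outer
  generalize (j : ℕ) = n
  induction n with
  | zero => rfl
  | succ n ih => rw [Function.iterate_succ_apply', CombMap.faceOf_next, ih]

theorem IsInner.notMem_of_pathVert_eq {X : Set c.map.Vertex} (hX : c.IsInner X) {j : Fin c.len}
    {s : ℕ} {v : c.map.Vertex} (h : c.pathVert j s = .inl v) : v ∉ X := by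
  unfold pathVert at h
  split_ifs at h
  · cases h
    exact hX _ (c.faceOf_border j)
  · cases h
    rw [← CombMap.vertexOf_next]
    exact hX _ ((c.map.faceOf_next _).trans (c.faceOf_border j))

theorem IsInner.faceOf_ne_of_mem_edgesAt {X : Set c.map.Vertex} (hX : c.IsInner X) {d : D}
    (hd : c.map.edgeOf d ∈ c.map.edgesAt X) : c.map.faceOf d ≠ c.outer := by
  obtain ⟨d', he, hd'⟩ := hd
  rw [CombMap.edgeOf_eq_edgeOf] at he
  rcases he with rfl | rfl
  · exact hX.faceOf_ne hd'
  · rw [← CombMap.faceOf_rot]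
    exact hX.faceOf_ne (by rwa [CombMap.vertexOf_rot])

/-- The edges of the constructed signed graph that have an end in the inner set `X`. -/
def innerEdges (c : CanonicalData D k) (X : Set c.map.Vertex) : Set c.Edg :=
  {f | ∃ e, f = .inl e ∧ (e : c.map.Edge) ∈ c.map.edgesAt X}

theorem IsInner.mem_innerEdges {X : Set c.map.Vertex} (hX : c.IsInner X) {f : c.Edg}
    {v : c.map.Vertex} (hv : v ∈ X) (hf : .inl v ∈ c.signedGraph.ends f) :
    f ∈ c.innerEdges X := by
  match f, hf with
  | .inl ⟨e, he⟩, hf =>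
    obtain ⟨d, rfl⟩ := c.map.exists_edgeOf_eq e
    refine ⟨_, rfl, ?_⟩
    change _ ∈ (c.map.graph.ends (c.map.edgeOf d)).map Sum.inl at hf
    rw [CombMap.ends_edgeOf, Sym2.map_mk, Sym2.mem_iff] at hf
    rcases hf with hf | hf
    · exact ⟨d, rfl, Sum.inl.inj hf ▸ hv⟩
    · exact ⟨c.map.rev d, c.map.edgeOf_rev d, Sum.inl.inj hf ▸ hv⟩
  | .inr (.inl ⟨j, s⟩), hf =>
    change _ ∈ s(c.pathVert j s, c.pathVert j (s + 1)) at hf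
    rw [Sym2.mem_iff] at hf
    rcases hf with hf | hf <;> exact absurd hv (hX.notMem_of_pathVert_eq hf.symm)
  | .inr (.inr i), hf =>
    change _ ∈ s(c.z _, c.z _) at hf
    rw [Sym2.mem_iff] at hf
    rcases hf with hf | hf <;> exact absurd hf Sum.inl_ne_inr

theorem mem_cut_inl (Z : Set c.Vert)
    (e : {e : c.map.Edge // ∀ d, c.map.edgeOf d = e → c.map.faceOf d ≠ c.outer}) :
    (.inl e : c.Edg) ∈ c.signedGraph.cut Z ↔
      (e : c.map.Edge) ∈ c.map.graph.cut (Sum.inl ⁻¹' Z) := by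
  constructor
  · rintro ⟨x, y, h, hx, hy⟩
    change (c.map.graph.ends e).map Sum.inl = _ at h
    obtain ⟨d, hd⟩ := c.map.exists_edgeOf_eq e
    rw [← hd, CombMap.ends_edgeOf, Sym2.map_mk, Sym2.eq_iff] at h
    rw [← hd, CombMap.edgeOf_mem_cut]
    rcases h with ⟨rfl, rfl⟩ | ⟨rfl, rfl⟩ <;> simp_all
  · rintro ⟨x, y, h, hx, hy⟩
    exact ⟨.inl x, .inl y, by
      change (c.map.graph.ends e).map Sum.inl = _
      rw [h, Sym2.map_mk], hx, hy⟩

/-- Edges of `G'` at `X` avoid `C'`, so they survive unsubdivided and positive in the signed graph.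
After switching they are negative exactly when they lie in the cut. -/
theorem IsInner.ncard_switch [Finite D] {X : Set c.map.Vertex} (hX : c.IsInner X)
    (Z : Set c.Vert) : (c.signedGraph.switch Z).neg.ncard =
      ((c.signedGraph.switch Z).neg \ c.innerEdges X).ncard +
        (c.map.edgesAt X ∩ c.map.graph.cut (Sum.inl ⁻¹' Z)).ncard := by
  rw [← Set.ncard_inter_add_ncard_sdiff_eq_ncard _ (c.innerEdges X) (Set.toFinite _), add_comm]
  congr 1
  symm
  refine Set.ncard_congr
    (fun e he => .inl ⟨e, fun d hd => hX.faceOf_ne_of_mem_edgesAt (hd ▸ he.1)⟩) ?_ ?_ ?_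
  · intro e he
    refine ⟨.inr ⟨(mem_cut_inl _ _).2 he.2, ?_⟩, _, rfl, he.1⟩
    rintro ⟨i, hi⟩
    cases hi
  · intro e e' he he' h
    simpa using h
  · rintro f ⟨hf, e, rfl, he⟩
    refine ⟨e, ⟨he, ?_⟩, rfl⟩
    rcases hf with ⟨⟨i, hi⟩, -⟩ | ⟨hf, -⟩
    · cases hi
    · exact (mem_cut_inl _ _).1 hf

/-- Moving vertices of `X` across the cut affects only edges with an end in `X`. -/
theorem IsInner.switch_diff_eq {X : Set c.map.Vertex} (hX : c.IsInner X)
    {Y Z : Set c.Vert} (h : ∀ x, x ∉ Sum.inl '' X → (x ∈ Y ↔ x ∈ Z)) :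
    (c.signedGraph.switch Y).neg \ c.innerEdges X =
      (c.signedGraph.switch Z).neg \ c.innerEdges X := by
  ext f
  refine and_congr_left fun hf => ?_
  change f ∈ symmDiff _ _ ↔ f ∈ symmDiff _ _
  rw [Set.mem_symmDiff, Set.mem_symmDiff, Multigraph.mem_cut_congr (X := Y) (Y := Z)]
  refine fun x hx => h x ?_
  rintro ⟨v, hv, rfl⟩
  exact hf (hX.mem_innerEdges hv hx)

/-- The trace at an inner vertex set `X` of a tight cut through a given edge: the set `A` of its
edges with an end in `X`, and the set `B` of the edges by which `A` is replaced when `X` is moved to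
the complementary side of the cut. -/
theorem IsInner.exists_trace [Finite D] (hc : c.signedGraph.IsCoveredByTightCuts)
    {X : Set c.map.Vertex} (hX : c.IsInner X) {d : D} (hd : c.map.vertexOf d ∈ X) :
    ∃ A B : Set c.map.Edge, c.map.edgeOf d ∈ A ∧ A ⊆ c.map.edgesAt X ∧ B ⊆ c.map.graph.cut X ∧
      A.ncard ≤ B.ncard ∧ A.ncard + B.ncard ≤ (c.map.graph.cut X).ncard ∧
      ∀ F, c.map.faceDegree (A.indicator 1) F = c.map.faceDegree (B.indicator 1) F := by
  classical
  obtain ⟨n, hmin, htight⟩ := hc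
  have hdX : c.map.edgeOf d ∈ c.map.edgesAt X := ⟨d, rfl, hd⟩
  obtain ⟨Y, hY, hn⟩ := htight
    (.inl ⟨c.map.edgeOf d, fun d' hd' => hX.faceOf_ne_of_mem_edgesAt (hd' ▸ hdX)⟩) (by
      rintro ⟨i, hi⟩
      cases hi)
  rw [mem_cut_inl] at hY
  set U : Set c.map.Vertex := Sum.inl ⁻¹' Y with hU
  have h1 := hX.ncard_switch Y
  rw [← hU] at h1
  -- The tight cut is compared with the two cuts that have `X` entirely on one side.
  have h2 := hX.ncard_switch (Y \ Sum.inl '' X)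
  have h3 := hX.ncard_switch (Y ∪ Sum.inl '' X)
  rw [← hX.switch_diff_eq (Y := Y) fun x hx => by simp_all] at h2
  rw [← hX.switch_diff_eq (Y := Y) fun x hx => by simp_all] at h3
  rw [Set.preimage_sdiff, Set.preimage_image_eq _ Sum.inl_injective, ← hU] at h2
  rw [Set.preimage_union, Set.preimage_image_eq _ Sum.inl_injective, ← hU] at h3
  have h2' := hmin (Y \ Sum.inl '' X)
  have h3' := hmin (Y ∪ Sum.inl '' X)
  have hB : c.map.edgesAt X ∩ c.map.graph.cut (U \ X) ⊆ c.map.graph.cut X := by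
    rintro _ ⟨⟨d, rfl, hd⟩, h⟩
    rw [CombMap.edgeOf_mem_cut] at h ⊢
    simp_all
  -- With all of `X` on one side, an edge inside `X` is never cut, and an edge leaving `X` is cut
  -- for exactly one of the two placements. The two placements thus share out `cut X`.
  have hB' : c.map.edgesAt X ∩ c.map.graph.cut (U ∪ X) =
      c.map.graph.cut X \ (c.map.edgesAt X ∩ c.map.graph.cut (U \ X)) := by
    ext e
    constructor
    · rintro ⟨⟨d, rfl, hd⟩, h⟩
      simp only [Set.mem_sdiff, Set.mem_inter_iff, CombMap.edgeOf_mem_cut, Set.mem_union] at h ⊢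
      tauto
    · rintro ⟨⟨x, y, he, hx, hy⟩, h⟩
      obtain ⟨d, rfl⟩ := c.map.exists_edgeOf_eq e
      have hd : c.map.edgeOf d ∈ c.map.edgesAt X := by
        rw [CombMap.ends_edgeOf, Sym2.eq_iff] at he
        rcases he with ⟨rfl, -⟩ | ⟨-, rfl⟩
        · exact ⟨d, rfl, hx⟩
        · exact ⟨c.map.rev d, c.map.edgeOf_rev d, hx⟩
      refine ⟨hd, ?_⟩
      rw [CombMap.ends_edgeOf, Sym2.eq_iff] at he
      simp only [Set.mem_inter_iff, CombMap.edgeOf_mem_cut, Set.mem_union, Set.mem_sdiff] at h ⊢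
      rcases he with ⟨rfl, rfl⟩ | ⟨rfl, rfl⟩ <;> tauto
  have hsum := Set.ncard_sdiff_add_ncard_of_subset hB (Set.toFinite _)
  rw [← hB'] at hsum
  refine ⟨c.map.edgesAt X ∩ c.map.graph.cut U, c.map.edgesAt X ∩ c.map.graph.cut (U \ X), ⟨hdX, hY⟩,
     Set.inter_subset_left, hB, by omega, by omega, fun F => ?_⟩
  rw [← CharTwo.add_eq_zero, ← CombMap.faceDegree_add]
  -- The cuts of `U` and `U \ X` agree on edges with no end in `X`. So `A + B` is a sum of two cuts,
  -- and cuts meet every face evenly.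
  have : (c.map.edgesAt X ∩ c.map.graph.cut U).indicator 1 +
      (c.map.edgesAt X ∩ c.map.graph.cut (U \ X)).indicator 1 =
      (c.map.graph.cut U).indicator 1 +
        ((c.map.graph.cut (U \ X)).indicator 1 : c.map.Edge → ZMod 2) := by
    funext e
    simp only [Pi.add_apply, Set.indicator_apply, Set.mem_inter_iff, Pi.one_apply]
    by_cases he : e ∈ c.map.edgesAt X
    · simp [he]
    · have : e ∈ c.map.graph.cut U ↔ e ∈ c.map.graph.cut (U \ X) := by
        obtain ⟨d, rfl⟩ := c.map.exists_edgeOf_eq e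
        have h1 : c.map.vertexOf d ∉ X := fun h => he ⟨d, rfl, h⟩
        have h2 : c.map.vertexOf (c.map.rev d) ∉ X := fun h => he ⟨_, c.map.edgeOf_rev d, h⟩
        simp [CombMap.edgeOf_mem_cut, h1, h2]
      simp only [he, false_and, if_false, this, CharTwo.add_self_eq_zero]
  rw [this, CombMap.faceDegree_add, CombMap.faceDegree_cut, CombMap.faceDegree_cut, add_zero]

end CanonicalData

namespace CombMap

variable {D : Type*} {M : CombMap D}

theorem incidence_edgeOf_self {d : D} (h : M.faceOf (M.rev d) ≠ M.faceOf d) :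
    M.incidence (M.faceOf d) (M.edgeOf d) = 1 := by
  simp [incidence_edgeOf, h]

theorem exists_dart_of_incidence_ne_zero {F : M.Face} {e : M.Edge} (h : M.incidence F e ≠ 0) :
    ∃ d, M.edgeOf d = e ∧ M.faceOf d = F := by
  obtain ⟨d, rfl⟩ := M.exists_edgeOf_eq e
  by_contra hd
  push Not at hd
  exact h (by simp [incidence_edgeOf, hd d rfl, hd _ (M.edgeOf_rev d)])

variable [Finite D]

theorem faceDegree_indicator_eq_sum {S : Set M.Edge} {F : M.Face} (T : Finset M.Edge)
    (hT : ∀ e ∈ S, e ∉ T → M.incidence F e = 0) :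
    M.faceDegree (S.indicator 1) F = ∑ e ∈ T, M.incidence F e * S.indicator 1 e := by
  rw [faceDegree]
  symm
  refine Finset.sum_subset (Finset.subset_univ T) fun e _ he => ?_
  by_cases heS : e ∈ S
  · rw [hT e heS he, zero_mul]
  · rw [Set.indicator_of_notMem heS, mul_zero]

theorem faceDegree_coe (T : Finset M.Edge) (F : M.Face) :
    M.faceDegree ((T : Set M.Edge).indicator 1) F = ∑ e ∈ T, M.incidence F e := by
  rw [faceDegree_indicator_eq_sum T fun e he he' => absurd he he']
  exact Finset.sum_congr rfl fun e he => by simp [he]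

theorem exists_dart_of_faceDegree_ne_zero {S : Set M.Edge} {F : M.Face}
    (h : M.faceDegree (S.indicator 1) F ≠ 0) : ∃ d, M.edgeOf d ∈ S ∧ M.faceOf d = F := by
  obtain ⟨e, -, he⟩ := Finset.exists_ne_zero_of_sum_ne_zero h
  have heS : e ∈ S := by
    by_contra heS
    exact he (by rw [Set.indicator_of_notMem heS, mul_zero])
  obtain ⟨d, rfl, hd⟩ := exists_dart_of_incidence_ne_zero (left_ne_zero_of_mul he)
  exact ⟨d, heS, hd⟩

end CombMap

/-! ### Dual cycles of length at most four -/

namespace CanonicalData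

variable {D : Type*} {k : ℕ} {c : CanonicalData D k}

/-- In a connected graph a cut determines its side up to complement, and both `X` and `Y` miss the
vertices of `C'`. -/
theorem IsInner.eq_of_cut_eq {X Y : Set c.map.Vertex} (hX : c.IsInner X) (hY : c.IsInner Y)
    (h : c.map.graph.cut X = c.map.graph.cut Y) : X = Y := by
  ext v
  obtain ⟨d, rfl⟩ := c.map.exists_vertexOf_eq v
  have := CombMap.eq_of_invariant c.isPlane.1
    (f := fun d => (c.map.vertexOf d ∈ X ↔ c.map.vertexOf d ∈ Y))
    (fun d => by rw [CombMap.vertexOf_rot]) (fun d => by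
      have := Set.ext_iff.1 h (c.map.edgeOf d)
      rw [CombMap.edgeOf_mem_cut, CombMap.edgeOf_mem_cut] at this
      apply propext
      tauto) d c.base
  simp only [hX c.base rfl, hY c.base rfl, iff_self, eq_iff_iff, iff_true] at this
  exact this

theorem exists_dart_mem {X : Set c.map.Vertex} {d : D}
    (h : c.map.edgeOf d ∈ c.map.graph.cut X) :
    ∃ d', c.map.edgeOf d' = c.map.edgeOf d ∧ c.map.vertexOf d' ∈ X := by
  rw [CombMap.edgeOf_mem_cut] at h
  by_cases hd : c.map.vertexOf d ∈ X
  · exact ⟨d, rfl, hd⟩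
  · exact ⟨_, c.map.edgeOf_rev d, by tauto⟩

theorem commonAdjFaces_comm (c : CanonicalData D k) (F₁ F₂ : c.map.Face) :
    c.commonAdjFaces F₁ F₂ = c.commonAdjFaces F₂ F₁ := by
  ext H
  exact and_congr_right fun _ => and_comm

variable [Finite D]

/-- Plane duality makes `S` a cut. As `S` contains no edge of `C'`, all of `C'` lies on one side,
and `X` is the other side: the interior of a dual cycle. -/
theorem exists_isInner_cut_eq {S : Set c.map.Edge}
    (hS : ∀ F, c.map.faceDegree (S.indicator 1) F = 0)
    (hout : ∀ d, c.map.edgeOf d ∈ S → c.map.faceOf d ≠ c.outer) :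
    ∃ X, c.IsInner X ∧ c.map.graph.cut X = S := by
  classical
  obtain ⟨x, hx⟩ := c.isPlane.exists_coboundary_eq hS
  have hx' : ∀ d, c.map.edgeOf d ∈ S ↔ x (c.map.vertexOf d) ≠ x (c.map.vertexOf (c.map.rev d)) := by
    intro d
    have h := congrFun hx (c.map.edgeOf d)
    rw [CombMap.coboundary_edgeOf] at h
    by_cases hd : c.map.edgeOf d ∈ S
    · rw [Set.indicator_of_mem hd] at h
      refine iff_of_true hd fun heq => ?_
      rw [heq, CharTwo.add_self_eq_zero] at h
      exact zero_ne_one h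
    · rw [Set.indicator_of_notMem hd, CharTwo.add_eq_zero] at h
      exact iff_of_false hd fun hne => hne h
  refine ⟨{v | x v ≠ x (c.map.vertexOf c.base)}, ?_, ?_⟩
  · intro d hd
    -- The value 0 off the outer face makes the function invariant under `next` on all darts.
    have := c.map.eq_of_faceOf_eq
      (f := fun d => if c.map.faceOf d = c.outer then x (c.map.vertexOf d) else 0) (fun d => by
        rw [CombMap.faceOf_next]
        split_ifs with hd
        · rw [CombMap.vertexOf_next]
          by_contra hne
          exact hout d ((hx' d).2 (Ne.symm hne)) hd
        · rfl) (d := d) (d' := c.base) hd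
    simp only [hd, if_true, show c.map.faceOf c.base = c.outer from rfl] at this
    simpa using this
  · ext e
    obtain ⟨d, rfl⟩ := c.map.exists_edgeOf_eq e
    rw [CombMap.edgeOf_mem_cut, hx']
    have : ∀ a b z : ZMod 2, (¬ (a ≠ z ↔ b ≠ z)) ↔ a ≠ b := by decide
    exact this _ _ _

/-- An edge off the outer face separates two distinct faces. -/
theorem faceOf_rev_ne (hc : c.signedGraph.IsCoveredByTightCuts) {d : D}
    (hd : c.map.faceOf d ≠ c.outer) : c.map.faceOf (c.map.rev d) ≠ c.map.faceOf d := by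
  intro h
  obtain ⟨X, hX, hcut⟩ := c.exists_isInner_cut_eq (S := {c.map.edgeOf d}) (fun F => by
    rw [← Finset.coe_singleton, CombMap.faceDegree_coe, Finset.sum_singleton,
      CombMap.incidence_edgeOf, h, CharTwo.add_self_eq_zero]) (fun d' hd' => by
    rw [Set.mem_singleton_iff, eq_comm, CombMap.edgeOf_eq_edgeOf] at hd'
    rcases hd' with rfl | rfl
    · exact hd
    · rwa [h])
  obtain ⟨d', -, hd'⟩ := c.exists_dart_mem (X := X) (d := d) (by simp [hcut])
  -- A cut of size one would give `2|A| ≤ 1`, although `A` is non-empty.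
  obtain ⟨A, B, hA, -, -, h1, h2, -⟩ := hX.exists_trace hc hd'
  rw [hcut, Set.ncard_singleton] at h2
  have := (Set.ncard_pos (Set.toFinite A)).2 ⟨_, hA⟩
  omega

theorem IsInner.faceOf_rot_ne (hc : c.signedGraph.IsCoveredByTightCuts)
    {X : Set c.map.Vertex} (hX : c.IsInner X) {d : D} (hd : c.map.vertexOf d ∈ X) :
    c.map.faceOf (c.map.rot d) ≠ c.map.faceOf d := by
  rw [CombMap.faceOf_rot]
  exact faceOf_rev_ne hc (hX.faceOf_ne hd)

/-- The three faces around a vertex off the outer face are distinct. -/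
theorem IsInner.faces_distinct (hc : c.signedGraph.IsCoveredByTightCuts)
    {X : Set c.map.Vertex} (hX : c.IsInner X) {d : D} (hd : c.map.vertexOf d ∈ X) :
    c.map.faceOf (c.map.rot d) ≠ c.map.faceOf d ∧
      c.map.faceOf (c.map.rot (c.map.rot d)) ≠ c.map.faceOf (c.map.rot d) ∧
      c.map.faceOf (c.map.rot (c.map.rot d)) ≠ c.map.faceOf d := by
  refine ⟨hX.faceOf_rot_ne hc hd, hX.faceOf_rot_ne hc (by rwa [CombMap.vertexOf_rot]), fun h => ?_⟩
  have := hX.faceOf_rot_ne hc (d := c.map.rot (c.map.rot d)) (by simpa [CombMap.vertexOf_rot])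
  rw [(c.isCubic d).2] at this
  exact this h.symm

/-- If the cut of an inner vertex set has at most three edges, then every face at a vertex of this
set is incident with an edge of the cut. -/
theorem IsInner.exists_faceOf_eq_of_ncard_cut_le (hc : c.signedGraph.IsCoveredByTightCuts)
    {X : Set c.map.Vertex} (hX : c.IsInner X) (h3 : (c.map.graph.cut X).ncard ≤ 3) {d : D}
    (hd : c.map.vertexOf d ∈ X) :
    ∃ d', c.map.edgeOf d' ∈ c.map.graph.cut X ∧ c.map.faceOf d' = c.map.faceOf d := by
  obtain ⟨A, B, hA, -, hB, h1, h2, hdeg⟩ := hX.exists_trace hc hd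
  -- From `2|A| ≤ 3`. The single edge of `A` has odd degree on the face of `d`, so `B` must have an
  -- edge there too.
  have hA1 : A = {c.map.edgeOf d} := (Set.eq_singleton_iff_unique_mem.2
    ⟨hA, fun e he => (Set.ncard_le_one_iff (Set.toFinite A)).1 (by omega) he hA⟩)
  have hne : c.map.faceDegree (B.indicator 1) (c.map.faceOf d) ≠ 0 := by
    rw [← hdeg, hA1, ← Finset.coe_singleton, CombMap.faceDegree_coe, Finset.sum_singleton,
      CombMap.incidence_edgeOf_self (faceOf_rev_ne hc (hX.faceOf_ne hd))]
    exact one_ne_zero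
  obtain ⟨d', hd', hF⟩ := CombMap.exists_dart_of_faceDegree_ne_zero hne
  exact ⟨d', hB hd', hF⟩

/-- Two distinct faces other than the outer one share at most one edge. -/
theorem dart_unique (hc : c.signedGraph.IsCoveredByTightCuts) {d d' : D}
    (hd : c.map.faceOf d ≠ c.outer) (hr : c.map.faceOf (c.map.rev d) ≠ c.outer)
    (h : c.map.faceOf d' = c.map.faceOf d)
    (h' : c.map.faceOf (c.map.rev d') = c.map.faceOf (c.map.rev d)) : d' = d := by
  classical
  by_contra hne
  have hloop := faceOf_rev_ne hc hd
  have hedge : c.map.edgeOf d ≠ c.map.edgeOf d' := by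
    rw [Ne, CombMap.edgeOf_eq_edgeOf]
    rintro (rfl | rfl)
    · exact hne rfl
    · exact hloop h
  have hS : ∀ a, c.map.edgeOf a ∈ ({c.map.edgeOf d, c.map.edgeOf d'} : Set c.map.Edge) →
      c.map.faceOf a = c.map.faceOf d ∨ c.map.faceOf a = c.map.faceOf (c.map.rev d) := by
    intro a ha
    rw [Set.mem_insert_iff, Set.mem_singleton_iff, eq_comm, CombMap.edgeOf_eq_edgeOf,
      eq_comm (a := c.map.edgeOf a), CombMap.edgeOf_eq_edgeOf] at ha
    rcases ha with (rfl | rfl) | (rfl | rfl) <;> simp [h, h']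
  obtain ⟨X, hX, hcut⟩ := c.exists_isInner_cut_eq (S := {c.map.edgeOf d, c.map.edgeOf d'})
    (fun F => by
      rw [← Finset.coe_pair, CombMap.faceDegree_coe, Finset.sum_pair hedge,
        CombMap.incidence_edgeOf, CombMap.incidence_edgeOf, h, h', CharTwo.add_self_eq_zero])
    (fun a ha => by rcases hS a ha with h | h <;> rwa [h])
  obtain ⟨b, -, hb⟩ := c.exists_dart_mem (X := X) (d := d) (by simp [hcut])
  have key : ∀ a, c.map.vertexOf a ∈ X →
      c.map.faceOf a = c.map.faceOf d ∨ c.map.faceOf a = c.map.faceOf (c.map.rev d) := by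
    intro a ha
    obtain ⟨a', ha', hF⟩ := hX.exists_faceOf_eq_of_ncard_cut_le hc
      (by rw [hcut, Set.ncard_pair hedge]; omega) ha
    exact hF ▸ hS a' (hcut ▸ ha')
  have k0 := key b hb
  have k1 := key (c.map.rot b) (by rwa [CombMap.vertexOf_rot])
  have k2 := key (c.map.rot (c.map.rot b)) (by rwa [CombMap.vertexOf_rot, CombMap.vertexOf_rot])
  -- The three faces around a vertex inside the dual 2-cycle are distinct, but only two are
  -- available.
  obtain ⟨n1, n2, n3⟩ := hX.faces_distinct hc hb
  grind

/-- If `F₁` and `F₂` have consecutive edges on `C'`, then the only common neighbour of `F₁` and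
`F₂` is the third face at the inner end of the edge between them. -/
theorem commonAdjFaces_subset_of_next_eq (hc : c.signedGraph.IsCoveredByTightCuts)
    {F₁ F₂ : c.map.Face} (hF : F₁ ≠ F₂) (hF₁ : F₁ ≠ c.outer) (hF₂ : F₂ ≠ c.outer) {d₁ d₂ : D}
    (ho₂ : c.map.faceOf d₂ = c.outer)
    (h₁ : c.map.faceOf (c.map.rev d₁) = F₁) (h₂ : c.map.faceOf (c.map.rev d₂) = F₂)
    (hnext : c.map.next d₁ = d₂) :
    c.commonAdjFaces F₁ F₂ ⊆
      {c.map.faceOf (c.map.rot (c.map.rot (c.map.rev (c.map.rot d₂))))} := by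
  classical
  rintro H ⟨hH, ⟨hH₁, a, rfl, ha⟩, hH₂, b, hab, hb⟩
  -- `rot d₂` is the third dart at the common vertex of the two consecutive edges, besides `d₂` and
  -- `rev d₁`. It separates `F₂` from `F₁`.
  have ht : c.map.faceOf (c.map.rot d₂) = F₂ := by rw [CombMap.faceOf_rot, h₂]
  have ht' : c.map.faceOf (c.map.rev (c.map.rot d₂)) = F₁ := by
    rw [← CombMap.faceOf_rot, ← h₁, ← (c.isCubic (c.map.rev d₁)).2, ← hnext, CombMap.next_apply]
  obtain ⟨t, htdef⟩ : ∃ t, t = c.map.rot d₂ := ⟨_, rfl⟩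
  rw [← htdef] at ht ht' ⊢
  have hta : c.map.edgeOf t ≠ c.map.edgeOf a := by
    rw [Ne, CombMap.edgeOf_eq_edgeOf]
    rintro (rfl | rfl)
    · exact hH₂ ht
    · exact hH₁ ht'
  have htb : c.map.edgeOf t ≠ c.map.edgeOf b := by
    rw [Ne, CombMap.edgeOf_eq_edgeOf]
    rintro (rfl | rfl)
    · exact hH₂ (hab.symm.trans ht)
    · exact hH₁ (hab.symm.trans ht')
  have hab' : c.map.edgeOf a ≠ c.map.edgeOf b := by
    rw [Ne, CombMap.edgeOf_eq_edgeOf]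
    rintro (rfl | rfl)
    · exact hF (ha.symm.trans hb)
    · exact hH₁ (hab.symm.trans ha)
  have hS : ∀ x, c.map.edgeOf x ∈
      ({c.map.edgeOf t, c.map.edgeOf a, c.map.edgeOf b} : Set c.map.Edge) →
      c.map.faceOf x = F₁ ∨ c.map.faceOf x = F₂ ∨ c.map.faceOf x = c.map.faceOf a := by
    intro x hx
    simp only [Set.mem_insert_iff, Set.mem_singleton_iff, eq_comm (a := c.map.edgeOf x),
      CombMap.edgeOf_eq_edgeOf] at hx
    rcases hx with (rfl | rfl) | (rfl | rfl) | (rfl | rfl) <;> simp [ht, ht', ha, hb, hab]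
  -- The interior of the dual triangle `F₁`, `F₂`, `H`. Since `t` starts on `C'`, its other end lies
  -- inside, and the third face there must be a face of the triangle, hence `H`.
  obtain ⟨X, hX, hcut⟩ := c.exists_isInner_cut_eq
    (S := {c.map.edgeOf t, c.map.edgeOf a, c.map.edgeOf b})
    (fun F => by
      have : ({c.map.edgeOf t, c.map.edgeOf a, c.map.edgeOf b} : Set c.map.Edge) =
        (({c.map.edgeOf t, c.map.edgeOf a, c.map.edgeOf b} : Finset c.map.Edge) :
          Set c.map.Edge) := by simp
      rw [this, CombMap.faceDegree_coe, Finset.sum_insert (by simp [hta, htb]),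
        Finset.sum_pair hab', CombMap.incidence_edgeOf, CombMap.incidence_edgeOf,
        CombMap.incidence_edgeOf, ht, ht', ha, hb, hab]
      generalize (if F₁ = F then (1 : ZMod 2) else 0) = x
      generalize (if F₂ = F then (1 : ZMod 2) else 0) = y
      generalize (if c.map.faceOf a = F then (1 : ZMod 2) else 0) = z
      revert x y z
      decide)
    (fun x hx => by rcases hS x hx with h | h | h <;> rwa [h])
  have hv : c.map.vertexOf t ∉ X := by
    rw [htdef, CombMap.vertexOf_rot]
    exact hX d₂ ho₂
  have hw : c.map.vertexOf (c.map.rev t) ∈ X := by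
    have : c.map.edgeOf t ∈ c.map.graph.cut X := by simp [hcut]
    rw [CombMap.edgeOf_mem_cut] at this
    tauto
  obtain ⟨n1, n2, n3⟩ := hX.faces_distinct hc hw
  obtain ⟨x, hx, hxF⟩ := hX.exists_faceOf_eq_of_ncard_cut_le hc
    (by rw [hcut]; exact (Set.ncard_insert_le _ _).trans (by rw [Set.ncard_pair hab']))
    (d := c.map.rot (c.map.rot (c.map.rev t))) (by simpa [CombMap.vertexOf_rot])
  rw [c.map.faceOf_rot (c.map.rev t), c.map.rev_rev, ht] at n2
  rw [ht'] at n3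
  rw [hcut] at hx
  rw [Set.mem_singleton_iff, ← hxF]
  rw [← hxF] at n2 n3
  rcases hS x hx with h | h | h
  · exact absurd h n3
  · exact absurd h n2
  · exact h.symm

theorem HaveConsecutiveEdges.ncard_commonAdjFaces_le
    (hc : c.signedGraph.IsCoveredByTightCuts) {F₁ F₂ : c.map.Face} (hF : F₁ ≠ F₂)
    (hF₁ : F₁ ≠ c.outer) (hF₂ : F₂ ≠ c.outer) (h : c.HaveConsecutiveEdges F₁ F₂) :
    (c.commonAdjFaces F₁ F₂).ncard ≤ 1 := by
  obtain ⟨d₁, d₂, ho₁, ho₂, h₁, h₂, hnext | hnext⟩ := h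
  · have := commonAdjFaces_subset_of_next_eq hc hF hF₁ hF₂ ho₂ h₁ h₂ hnext
    exact (Set.ncard_le_ncard this).trans (Set.ncard_singleton _).le
  · have := commonAdjFaces_subset_of_next_eq hc hF.symm hF₂ hF₁ ho₁ h₂ h₁ hnext
    rw [commonAdjFaces_comm]
    exact (Set.ncard_le_ncard this).trans (Set.ncard_singleton _).le

/-- The third face at the start of a dart inside a region bounded by a dual 4-cycle
`F₁ H₁ F₂ H₂`. -/
theorem IsInner.faceOf_rot_rot_eq (hc : c.signedGraph.IsCoveredByTightCuts)
    {X : Set c.map.Vertex} (hX : c.IsInner X) {F₁ F₂ H₁ H₂ : c.map.Face}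
    (hne : H₁ ≠ H₂)
    (h4 : (c.map.graph.cut X).ncard ≤ 4)
    (hpar : ∀ e ∈ c.map.graph.cut X, c.map.incidence H₁ e + c.map.incidence H₂ e = 1)
    (hcorner : ∀ d, c.map.edgeOf d ∈ c.map.graph.cut X → c.map.faceOf d = F₁ ∨
      c.map.faceOf d = F₂ ∨ c.map.faceOf d = H₁ ∨ c.map.faceOf d = H₂)
    {p : D} (hp : c.map.vertexOf p ∈ X) (hpF : c.map.faceOf p = F₁)
    (hn₂ : c.map.faceOf (c.map.rev p) ≠ F₂) (hn₃ : c.map.faceOf (c.map.rev p) ≠ H₁)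
    (hn₄ : c.map.faceOf (c.map.rev p) ≠ H₂)
    (hadj : ¬ (c.map.FaceAdj (c.map.faceOf (c.map.rev p)) H₁ ∧
      c.map.FaceAdj (c.map.faceOf (c.map.rev p)) H₂)) :
    c.map.faceOf (c.map.rot (c.map.rot p)) = F₂ := by
  classical
  by_contra hG₂
  obtain ⟨n1, n2, n3⟩ := hX.faces_distinct hc hp
  have hdX : c.map.vertexOf (c.map.rot p) ∈ X := by rwa [CombMap.vertexOf_rot]
  rw [← CombMap.faceOf_rot] at hn₂ hn₃ hn₄ hadj
  rw [c.map.faceOf_rot (c.map.rot p)] at hG₂ n2 n3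
  rw [hpF] at n1 n3
  obtain ⟨A, B, hA, hAX, hB, h1, h2, hdeg⟩ := hX.exists_trace hc hdX
  have hout := hX.faceOf_ne hdX
  have hout' : c.map.faceOf (c.map.rev (c.map.rot p)) ≠ c.outer := by
    rw [← CombMap.faceOf_rot]
    exact hX.faceOf_ne (by rwa [CombMap.vertexOf_rot])
  set d := c.map.rot p
  -- A face where `A` has odd degree meets `B`, hence is a corner of the dual 4-cycle.
  have hBc : ∀ F, c.map.faceDegree (A.indicator 1) F ≠ 0 → F = F₁ ∨ F = F₂ ∨ F = H₁ ∨ F = H₂ := by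
    intro F hF
    rw [hdeg] at hF
    obtain ⟨x, hx, rfl⟩ := CombMap.exists_dart_of_faceDegree_ne_zero hF
    exact hcorner x (hB hx)
  -- The face of `d` is not a corner, so `A` meets it evenly and has a second edge on it. As `2|A| ≤
  -- 4`, there are no further edges in `A`.
  obtain ⟨d', hd', hed, hdd⟩ : ∃ d', c.map.edgeOf d' ∈ A ∧ c.map.edgeOf d' ≠ c.map.edgeOf d ∧
      c.map.faceOf d' = c.map.faceOf d := by
    by_contra hno
    push Not at hno
    have h0 : c.map.faceDegree (A.indicator 1) (c.map.faceOf d) ≠ 0 := by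
      rw [CombMap.faceDegree_indicator_eq_sum {c.map.edgeOf d}, Finset.sum_singleton,
        CombMap.incidence_edgeOf_self n2, Set.indicator_of_mem hA]
      · exact one_ne_zero
      · intro e he hne
        by_contra hinc
        obtain ⟨x, rfl, hx⟩ := CombMap.exists_dart_of_incidence_ne_zero hinc
        exact hno x he (by simpa using hne) hx
    have := hBc _ h0
    tauto
  have hA2 : A = {c.map.edgeOf d, c.map.edgeOf d'} := by
    refine (Set.eq_of_subset_of_ncard_le (Set.insert_subset hA (Set.singleton_subset_iff.2 hd'))
      ?_ (Set.toFinite _)).symm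
    rw [Set.ncard_pair hed.symm]
    omega
  have hdegA : ∀ F, c.map.faceDegree (A.indicator 1) F =
      c.map.incidence F (c.map.edgeOf d) + c.map.incidence F (c.map.edgeOf d') := fun F => by
    rw [hA2, ← Finset.coe_pair, CombMap.faceDegree_coe, Finset.sum_pair hed.symm]
  have hB2 : B.ncard = 2 := by
    have : A.ncard = 2 := by rw [hA2, Set.ncard_pair hed.symm]
    omega
  -- Since two faces share at most one edge, the two edges of `A` lead to different faces. The one
  -- across `d` therefore has odd degree in `A` and is a corner.
  have hGne : c.map.faceOf (c.map.rev d') ≠ c.map.faceOf (c.map.rev d) := fun h =>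
    hed (congrArg _ (dart_unique hc hout hout' hdd h))
  have hGcorner := hBc (c.map.faceOf (c.map.rev d)) (by
    rw [hdegA, CombMap.incidence_edgeOf, CombMap.incidence_edgeOf]
    simp [hdd, n2.symm, hGne])
  -- Every edge of `B` is on exactly one of `H₁`, `H₂`, and `|B| = 2`. So if one edge of `A` leads
  -- to `H₁` or `H₂`, the other edge leads to the other of these faces, contradicting `hadj`.
  have hsum : c.map.faceDegree (A.indicator 1) H₁ + c.map.faceDegree (A.indicator 1) H₂ = 0 := by
    rw [hdeg, hdeg, CombMap.faceDegree, CombMap.faceDegree, ← Finset.sum_add_distrib]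
    have : ∀ e, c.map.incidence H₁ e * B.indicator 1 e + c.map.incidence H₂ e * B.indicator 1 e =
        if e ∈ B then 1 else 0 := by
      intro e
      rw [← add_mul]
      by_cases he : e ∈ B
      · simp [he, hpar e (hB he)]
      · simp [he]
    rw [Finset.sum_congr rfl fun e _ => this e, Finset.sum_boole]
    have hcard : (Finset.univ.filter (· ∈ B)).card = B.ncard := by
      rw [← Set.ncard_coe_finset]
      simp
    rw [hcard, hB2]
    rfl
  simp only [hdegA, CombMap.incidence_edgeOf, hdd, if_neg hn₃, if_neg hn₄, zero_add] at hsum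
  have hback : ∀ x H, c.map.faceOf x = c.map.faceOf d → c.map.faceOf d ≠ H →
      c.map.faceOf (c.map.rev x) = H → c.map.FaceAdj (c.map.faceOf d) H :=
    fun x H h1 h2 h3 => ⟨h2, x, h1, h3⟩
  rcases hGcorner with h | h | h | h
  · exact n3 h
  · exact hG₂ h
  · have hG' : c.map.faceOf (c.map.rev d') = H₂ := by
      by_contra hG'
      simp [h, h ▸ hGne, hne, hG'] at hsum
    exact hadj ⟨hback d _ rfl hn₃ h, hback d' _ hdd hn₄ hG'⟩
  · have hG' : c.map.faceOf (c.map.rev d') = H₁ := by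
      by_contra hG'
      simp [h, h ▸ hGne, hne.symm, hG'] at hsum
    exact hadj ⟨hback d' _ hdd hn₃ hG', hback d _ rfl hn₄ h⟩

end CanonicalData

/-! ### Regions bounded by two common neighbours -/

namespace CombMap

variable {D : Type*} {M : CombMap D}

/-- A boundary walk that uses no edge of the cut stays on one side of it. -/
theorem vertexOf_mem_iff_of_faceOf_eq {X : Set M.Vertex} {F : M.Face}
    (h : ∀ d, M.faceOf d = F → M.edgeOf d ∉ M.graph.cut X) {d d' : D} (hd : M.faceOf d = F)
    (hd' : M.faceOf d' = F) : M.vertexOf d ∈ X ↔ M.vertexOf d' ∈ X := by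
  have := M.eq_of_faceOf_eq (f := fun d => (M.faceOf d = F ∧ M.vertexOf d ∈ X)) (fun a => by
    rw [faceOf_next, vertexOf_next]
    apply propext
    refine and_congr_right fun ha => ?_
    have := h a ha
    rw [edgeOf_mem_cut, not_not] at this
    exact this.symm) (hd.trans hd'.symm)
  simpa [hd, hd'] using this

theorem vertexOf_notMem_of_mem_cut {W Y : Set M.Vertex} (hs : W ⊆ Y) {d : D}
    (hY : M.edgeOf d ∈ M.graph.cut Y) (hW : M.edgeOf d ∉ M.graph.cut W) : M.vertexOf d ∉ W := by
  rw [edgeOf_mem_cut] at hY hW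
  have h1 := @hs (M.vertexOf d)
  have h2 := @hs (M.vertexOf (M.rev d))
  tauto

theorem vertexOf_mem_of_mem_cut {W Y : Set M.Vertex} (hs : W ⊆ Y) {d : D}
    (hW : M.edgeOf d ∈ M.graph.cut W) (hY : M.edgeOf d ∉ M.graph.cut Y) : M.vertexOf d ∈ Y := by
  rw [edgeOf_mem_cut] at hY hW
  have h1 := @hs (M.vertexOf d)
  have h2 := @hs (M.vertexOf (M.rev d))
  tauto

theorem cut_inter_subset (X Y : Set M.Vertex) :
    M.graph.cut (X ∩ Y) ⊆ M.graph.cut X ∪ M.graph.cut Y := by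
  intro e he
  obtain ⟨d, rfl⟩ := M.exists_edgeOf_eq e
  simp only [Set.mem_union, edgeOf_mem_cut, Set.mem_inter_iff] at he ⊢
  tauto

theorem cut_symmDiff (X Y : Set M.Vertex) :
    M.graph.cut (symmDiff X Y) = symmDiff (M.graph.cut X) (M.graph.cut Y) := by
  ext e
  obtain ⟨d, rfl⟩ := M.exists_edgeOf_eq e
  simp only [Set.mem_symmDiff, edgeOf_mem_cut]
  tauto

theorem cut_empty : M.graph.cut ∅ = ∅ := by
  ext e
  obtain ⟨d, rfl⟩ := M.exists_edgeOf_eq e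
  simp [edgeOf_mem_cut]

end CombMap

namespace CanonicalData

variable {D : Type*} {k : ℕ} {c : CanonicalData D k}

/-- A choice, for every common neighbour `H` of two faces `F₁` and `F₂`, of an edge between `F₁` and
`H` and an edge between `F₂` and `H`. -/
structure Links (c : CanonicalData D k) (F₁ F₂ : c.map.Face) where
  /-- A dart on `F₁` whose edge borders `H`. -/
  fst : c.map.Face → D
  /-- A dart on `F₂` whose edge borders `H`. -/
  snd : c.map.Face → D
  ne : F₁ ≠ F₂
  ne_outer₁ : F₁ ≠ c.outer
  ne_outer₂ : F₂ ≠ c.outer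
  faceOf_fst : ∀ H ∈ c.commonAdjFaces F₁ F₂, c.map.faceOf (fst H) = F₁
  faceOf_snd : ∀ H ∈ c.commonAdjFaces F₁ F₂, c.map.faceOf (snd H) = F₂
  faceOf_rev_fst : ∀ H ∈ c.commonAdjFaces F₁ F₂, c.map.faceOf (c.map.rev (fst H)) = H
  faceOf_rev_snd : ∀ H ∈ c.commonAdjFaces F₁ F₂, c.map.faceOf (c.map.rev (snd H)) = H

theorem exists_links {F₁ F₂ : c.map.Face} (hF : F₁ ≠ F₂) (hF₁ : F₁ ≠ c.outer)
    (hF₂ : F₂ ≠ c.outer) : Nonempty (c.Links F₁ F₂) := by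
  have : ∀ H, ∃ p q, H ∈ c.commonAdjFaces F₁ F₂ → c.map.faceOf p = F₁ ∧ c.map.faceOf q = F₂ ∧
      c.map.faceOf (c.map.rev p) = H ∧ c.map.faceOf (c.map.rev q) = H := by
    intro H
    by_cases hH : H ∈ c.commonAdjFaces F₁ F₂
    · obtain ⟨-, ⟨-, a, ha, ha'⟩, -, b, hb, hb'⟩ := hH
      exact ⟨c.map.rev a, c.map.rev b, fun _ =>
        ⟨ha', hb', by rwa [c.map.rev_rev], by rwa [c.map.rev_rev]⟩⟩
    · exact ⟨c.base, c.base, fun h => absurd h hH⟩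
  choose p q h using this
  exact ⟨⟨p, q, hF, hF₁, hF₂, fun H hH => (h H hH).1, fun H hH => (h H hH).2.1,
    fun H hH => (h H hH).2.2.1, fun H hH => (h H hH).2.2.2⟩⟩

namespace Links

variable {F₁ F₂ : c.map.Face} (l : c.Links F₁ F₂)

/-- The edge between `F₁` and `H`. -/
def edgeFst (H : c.map.Face) : c.map.Edge := c.map.edgeOf (l.fst H)

/-- The edge between `F₂` and `H`. -/
def edgeSnd (H : c.map.Face) : c.map.Edge := c.map.edgeOf (l.snd H)

/-- The edges of the dual 4-cycle `F₁ H F₂ H'`. -/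
def quad (H H' : c.map.Face) : Set c.map.Edge :=
  {l.edgeFst H, l.edgeSnd H, l.edgeFst H', l.edgeSnd H'}

variable {l} {H H' H'' : c.map.Face}

theorem edgeFst_ne (hH : H ∈ c.commonAdjFaces F₁ F₂) (hH' : H' ∈ c.commonAdjFaces F₁ F₂)
    (hne : H ≠ H') : l.edgeFst H ≠ l.edgeFst H' := by
  refine fun h => hne ?_
  rcases (c.map.edgeOf_eq_edgeOf).1 h with h | h
  · rw [← l.faceOf_rev_fst H hH, ← h, l.faceOf_rev_fst H' hH']
  · exact absurd (by rw [← l.faceOf_fst H' hH', h, l.faceOf_rev_fst H hH]) hH.2.1.1.symm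

theorem edgeSnd_ne (hH : H ∈ c.commonAdjFaces F₁ F₂) (hH' : H' ∈ c.commonAdjFaces F₁ F₂)
    (hne : H ≠ H') : l.edgeSnd H ≠ l.edgeSnd H' := by
  refine fun h => hne ?_
  rcases (c.map.edgeOf_eq_edgeOf).1 h with h | h
  · rw [← l.faceOf_rev_snd H hH, ← h, l.faceOf_rev_snd H' hH']
  · exact absurd (by rw [← l.faceOf_snd H' hH', h, l.faceOf_rev_snd H hH]) hH.2.2.1.symm

theorem edgeFst_ne_edgeSnd (hH : H ∈ c.commonAdjFaces F₁ F₂)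
    (hH' : H' ∈ c.commonAdjFaces F₁ F₂) : l.edgeFst H ≠ l.edgeSnd H' := by
  intro h
  rcases (c.map.edgeOf_eq_edgeOf).1 h with h | h
  · exact l.ne (by rw [← l.faceOf_fst H hH, ← h, l.faceOf_snd H' hH'])
  · exact hH.2.2.1.symm (by rw [← l.faceOf_snd H' hH', h, l.faceOf_rev_fst H hH])

open Classical in
theorem incidence_edgeFst (hH : H ∈ c.commonAdjFaces F₁ F₂) (G : c.map.Face) :
    c.map.incidence G (l.edgeFst H) = (if F₁ = G then 1 else 0) + (if H = G then 1 else 0) := by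
  rw [edgeFst, CombMap.incidence_edgeOf, l.faceOf_fst H hH, l.faceOf_rev_fst H hH]

open Classical in
theorem incidence_edgeSnd (hH : H ∈ c.commonAdjFaces F₁ F₂) (G : c.map.Face) :
    c.map.incidence G (l.edgeSnd H) = (if F₂ = G then 1 else 0) + (if H = G then 1 else 0) := by
  rw [edgeSnd, CombMap.incidence_edgeOf, l.faceOf_snd H hH, l.faceOf_rev_snd H hH]

theorem faceOf_eq_of_mem_quad (hH : H ∈ c.commonAdjFaces F₁ F₂)
    (hH' : H' ∈ c.commonAdjFaces F₁ F₂) {d : D} (hd : c.map.edgeOf d ∈ l.quad H H') :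
    c.map.faceOf d = F₁ ∨ c.map.faceOf d = F₂ ∨ c.map.faceOf d = H ∨ c.map.faceOf d = H' := by
  simp only [quad, edgeFst, edgeSnd, Set.mem_insert_iff, Set.mem_singleton_iff,
    eq_comm (a := c.map.edgeOf d), CombMap.edgeOf_eq_edgeOf] at hd
  rcases hd with (rfl | rfl) | (rfl | rfl) | (rfl | rfl) | (rfl | rfl) <;>
    simp [l.faceOf_fst, l.faceOf_snd, l.faceOf_rev_fst, l.faceOf_rev_snd, hH, hH']

theorem quad_nonempty : (l.quad H H').Nonempty := ⟨l.edgeFst H, by simp [quad]⟩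

/-- The three dual paths from `F₁` to `F₂` through `H`, `H'`, `H''` have no edge in common, and each
`quad` is the union of two of them. -/
theorem symmDiff_quad (hH : H ∈ c.commonAdjFaces F₁ F₂) (hH' : H' ∈ c.commonAdjFaces F₁ F₂)
    (hH'' : H'' ∈ c.commonAdjFaces F₁ F₂) (h₁ : H ≠ H') (h₂ : H ≠ H'') (h₃ : H' ≠ H'') :
    symmDiff (l.quad H H') (l.quad H H'') = l.quad H' H'' := by
  have a1 := l.edgeFst_ne hH hH' h₁
  have a2 := l.edgeFst_ne hH hH'' h₂
  have a3 := l.edgeFst_ne hH' hH'' h₃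
  have b1 := l.edgeSnd_ne hH hH' h₁
  have b2 := l.edgeSnd_ne hH hH'' h₂
  have b3 := l.edgeSnd_ne hH' hH'' h₃
  have c1 := l.edgeFst_ne_edgeSnd hH hH'
  have c2 := l.edgeFst_ne_edgeSnd hH hH''
  have c3 := l.edgeFst_ne_edgeSnd hH' hH
  have c4 := l.edgeFst_ne_edgeSnd hH' hH''
  have c5 := l.edgeFst_ne_edgeSnd hH'' hH
  have c6 := l.edgeFst_ne_edgeSnd hH'' hH'
  ext e
  simp only [Set.mem_symmDiff, quad, Set.mem_insert_iff, Set.mem_singleton_iff]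
  grind

variable [Finite D]

theorem exists_region (l : c.Links F₁ F₂) (hH : H ∈ c.commonAdjFaces F₁ F₂)
    (hH' : H' ∈ c.commonAdjFaces F₁ F₂) (hne : H ≠ H') :
    ∃ X, c.IsInner X ∧ c.map.graph.cut X = l.quad H H' := by
  classical
  refine c.exists_isInner_cut_eq (fun F => ?_) fun d hd => ?_
  · have : l.quad H H' = (({l.edgeFst H, l.edgeSnd H, l.edgeFst H', l.edgeSnd H'} :
        Finset c.map.Edge) : Set c.map.Edge) := by simp [quad]
    have n1 := l.edgeFst_ne hH hH' hne
    have n2 := l.edgeSnd_ne hH hH' hne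
    have n3 := l.edgeFst_ne_edgeSnd hH hH
    have n4 := l.edgeFst_ne_edgeSnd hH hH'
    have n5 := (l.edgeFst_ne_edgeSnd hH' hH).symm
    have n6 := l.edgeFst_ne_edgeSnd hH' hH'
    rw [this, CombMap.faceDegree_coe, Finset.sum_insert (by simp [n1, n3, n4]),
      Finset.sum_insert (by simp [n5, n2]), Finset.sum_pair n6, incidence_edgeFst hH,
      incidence_edgeFst hH', incidence_edgeSnd hH, incidence_edgeSnd hH']
    generalize (if F₁ = F then (1 : ZMod 2) else 0) = x
    generalize (if F₂ = F then (1 : ZMod 2) else 0) = y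
    generalize (if H = F then (1 : ZMod 2) else 0) = z
    generalize (if H' = F then (1 : ZMod 2) else 0) = w
    revert x y z w
    decide
  · rcases faceOf_eq_of_mem_quad hH hH' hd with h | h | h | h <;> rw [h]
    · exact l.ne_outer₁
    · exact l.ne_outer₂
    · exact hH.1
    · exact hH'.1

/-- These are all the even subgraphs of a dual theta graph. Parity at a middle face puts both or
neither of its two edges into `T`, and parity at `F₁` makes the number of paths used even. -/
theorem eq_empty_or_eq_quad (hH : H ∈ c.commonAdjFaces F₁ F₂)
    (hH' : H' ∈ c.commonAdjFaces F₁ F₂) (hH'' : H'' ∈ c.commonAdjFaces F₁ F₂) (h₁ : H ≠ H')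
    (h₂ : H ≠ H'') (h₃ : H' ≠ H'') {T : Set c.map.Edge}
    (hT : T ⊆ l.quad H H' ∪ l.quad H H'') (hdeg : ∀ F, c.map.faceDegree (T.indicator 1) F = 0) :
    T = ∅ ∨ T = l.quad H H' ∨ T = l.quad H H'' ∨ T = l.quad H' H'' := by
  classical
  have hT' : ∀ e ∈ T, ∃ K ∈ c.commonAdjFaces F₁ F₂, (K = H ∨ K = H' ∨ K = H'') ∧
      (e = l.edgeFst K ∨ e = l.edgeSnd K) := by
    intro e he
    have := hT he
    simp only [quad, Set.mem_union, Set.mem_insert_iff, Set.mem_singleton_iff] at this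
    rcases this with (h | h | h | h) | (h | h | h | h)
    exacts [⟨H, hH, by simp [h]⟩, ⟨H, hH, by simp [h]⟩, ⟨H', hH', by simp [h]⟩,
      ⟨H', hH', by simp [h]⟩, ⟨H, hH, by simp [h]⟩, ⟨H, hH, by simp [h]⟩, ⟨H'', hH'', by simp [h]⟩,
      ⟨H'', hH'', by simp [h]⟩]
  have hpair : ∀ K ∈ c.commonAdjFaces F₁ F₂, l.edgeFst K ∈ T ↔ l.edgeSnd K ∈ T := by
    intro K hK
    have := hdeg K
    rw [CombMap.faceDegree_indicator_eq_sum {l.edgeFst K, l.edgeSnd K},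
      Finset.sum_pair (edgeFst_ne_edgeSnd hK hK), incidence_edgeFst hK, incidence_edgeSnd hK,
      if_neg hK.2.1.1.symm, if_neg hK.2.2.1.symm] at this
    · simp only [Set.indicator_apply, if_true, Pi.one_apply, zero_add, one_mul] at this
      by_cases a : l.edgeFst K ∈ T <;> by_cases b : l.edgeSnd K ∈ T <;> simp_all
    · intro e he heK
      obtain ⟨L, hL, -, rfl | rfl⟩ := hT' e he
      · have : L ≠ K := by
          rintro rfl
          simp at heK
        simp [incidence_edgeFst hL, this, hK.2.1.1.symm]
      · have : L ≠ K := by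
          rintro rfl
          simp at heK
        simp [incidence_edgeSnd hL, this, hK.2.2.1.symm]
  have a1 := l.edgeFst_ne hH hH' h₁
  have a2 := l.edgeFst_ne hH hH'' h₂
  have a3 := l.edgeFst_ne hH' hH'' h₃
  have hsum := hdeg F₁
  rw [CombMap.faceDegree_indicator_eq_sum {l.edgeFst H, l.edgeFst H', l.edgeFst H''},
    Finset.sum_insert (by simp [a1, a2]), Finset.sum_pair a3, incidence_edgeFst hH,
    incidence_edgeFst hH', incidence_edgeFst hH'', if_neg hH.2.1.1, if_neg hH'.2.1.1,
    if_neg hH''.2.1.1] at hsum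
  · simp only [Set.indicator_apply, if_true, Pi.one_apply, add_zero, one_mul] at hsum
    have p1 := hpair H hH
    have p2 := hpair H' hH'
    have p3 := hpair H'' hH''
    by_cases x : l.edgeFst H ∈ T <;> by_cases y : l.edgeFst H' ∈ T <;>
      by_cases z : l.edgeFst H'' ∈ T <;> simp only [x, y, z, if_true, if_false, true_iff, false_iff]
        at p1 p2 p3 hsum
    · exact absurd hsum (by decide)
    · refine .inr (.inl (Set.Subset.antisymm (fun e he => ?_) ?_))
      · obtain ⟨K, -, rfl | rfl | rfl, rfl | rfl⟩ := hT' e he <;>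
          first | contradiction | simp [quad]
      · rintro e (rfl | rfl | rfl | rfl) <;> assumption
    · refine .inr (.inr (.inl (Set.Subset.antisymm (fun e he => ?_) ?_)))
      · obtain ⟨K, -, rfl | rfl | rfl, rfl | rfl⟩ := hT' e he <;>
          first | contradiction | simp [quad]
      · rintro e (rfl | rfl | rfl | rfl) <;> assumption
    · exact absurd hsum (by decide)
    · refine .inr (.inr (.inr (Set.Subset.antisymm (fun e he => ?_) ?_)))
      · obtain ⟨K, -, rfl | rfl | rfl, rfl | rfl⟩ := hT' e he <;>
          first | contradiction | simp [quad]
      · rintro e (rfl | rfl | rfl | rfl) <;> assumption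
    · exact absurd hsum (by decide)
    · exact absurd hsum (by decide)
    · refine .inl (Set.eq_empty_of_forall_notMem fun e he => ?_)
      obtain ⟨K, -, rfl | rfl | rfl, rfl | rfl⟩ := hT' e he <;> contradiction
  · intro e he heK
    obtain ⟨L, hL, hLL, rfl | rfl⟩ := hT' e he
    · rcases hLL with rfl | rfl | rfl <;> simp at heK
    · simp [incidence_edgeSnd hL, l.ne.symm, hL.2.1.1]

end Links

end CanonicalData

/-! ### Nested regions and the bound three -/

namespace CanonicalData

variable {D : Type*} {k : ℕ} {c : CanonicalData D k}

namespace Links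

variable {F₁ F₂ : c.map.Face} {l : c.Links F₁ F₂} {H H' H'' L : c.map.Face}

theorem region_eq_symmDiff (hH : H ∈ c.commonAdjFaces F₁ F₂)
    (hH' : H' ∈ c.commonAdjFaces F₁ F₂) (hH'' : H'' ∈ c.commonAdjFaces F₁ F₂) (h₁ : H ≠ H')
    (h₂ : H ≠ H'') (h₃ : H' ≠ H'') {X Y Z : Set c.map.Vertex}
    (hX : c.IsInner X) (hXc : c.map.graph.cut X = l.quad H H')
    (hY : c.IsInner Y) (hYc : c.map.graph.cut Y = l.quad H H'')
    (hZ : c.IsInner Z) (hZc : c.map.graph.cut Z = l.quad H' H'') : Z = symmDiff X Y := by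
  refine hZ.eq_of_cut_eq (fun d hd => ?_) ?_
  · rw [Set.mem_symmDiff]
    exact not_or_intro (fun h => hX d hd h.1) (fun h => hY d hd h.1)
  · rw [CombMap.cut_symmDiff, hXc, hYc, hZc, symmDiff_quad hH hH' hH'' h₁ h₂ h₃]

theorem region_nonempty {X : Set c.map.Vertex} (hXc : c.map.graph.cut X = l.quad H H') :
    X.Nonempty := by
  obtain ⟨e, he⟩ := hXc ▸ l.quad_nonempty (H := H) (H' := H')
  obtain ⟨x, -, -, hx, -⟩ := he
  exact ⟨x, hx⟩

variable [Finite D]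

/-- If `Y` is at least as large as `X` and `Z`, where `X`, `Y`, `Z` are the regions bounded by the
three 4-cycles through `F₁`, `F₂` and two of the common neighbours `H`, `L`, `H'`, then `Y` is the
disjoint union of `X` and `Z`. -/
theorem region_subset (hH : H ∈ c.commonAdjFaces F₁ F₂) (hL : L ∈ c.commonAdjFaces F₁ F₂)
    (hH' : H' ∈ c.commonAdjFaces F₁ F₂) (h₁ : H ≠ L) (h₂ : H ≠ H') (h₃ : L ≠ H')
    {X Y Z : Set c.map.Vertex}
    (hX : c.IsInner X) (hXc : c.map.graph.cut X = l.quad H L)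
    (hY : c.IsInner Y) (hYc : c.map.graph.cut Y = l.quad H H')
    (hZ : c.IsInner Z) (hZc : c.map.graph.cut Z = l.quad L H')
    (hXY : X.ncard ≤ Y.ncard) (hZY : Z.ncard ≤ Y.ncard) : X ⊆ Y ∧ Z = Y \ X := by
  have hZe := region_eq_symmDiff hH hL hH' h₁ h₂ h₃ hX hXc hY hYc hZ hZc
  have hWin : c.IsInner (X ∩ Y) := fun d hd h => hX d hd h.1
  have hXne := region_nonempty hXc
  have hZne := region_nonempty hZc
  -- The cut of `X ∩ Y` lies in the theta graph, so `X ∩ Y` is empty or one of `X`, `Y`, `Z`. As `Z`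
  -- is the symmetric difference of `X` and `Y`, the choice `∅` makes `Z` larger than `Y`, the
  -- choice `Y` makes `Z` empty, and the choice `Z` is absurd. Only `X ⊆ Y` remains.
  have hcase := eq_empty_or_eq_quad (l := l) hH hL hH' h₁ h₂ h₃
    (T := c.map.graph.cut (X ∩ Y)) (by
      rw [← hXc, ← hYc]
      exact CombMap.cut_inter_subset X Y) (CombMap.faceDegree_cut _)
  rw [← hXc, ← hYc, ← hZc] at hcase
  rcases hcase with h | h | h | h
  · have hW : X ∩ Y = ∅ := hWin.eq_of_cut_eq (fun d _ h => h) (h.trans CombMap.cut_empty.symm)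
    have hdis : Disjoint X Y := Set.disjoint_iff_inter_eq_empty.2 hW
    have hcard := Set.ncard_union_eq hdis (Set.toFinite X) (Set.toFinite Y)
    have hZU : Z = X ∪ Y := hZe.trans hdis.symmDiff_eq_sup
    rw [← hZU] at hcard
    have := (Set.ncard_pos (Set.toFinite X)).2 hXne
    omega
  · have hW : X ∩ Y = X := hWin.eq_of_cut_eq hX h
    have hsub : X ⊆ Y := Set.inter_eq_left.1 hW
    refine ⟨hsub, hZe.trans ?_⟩
    rw [symmDiff_of_le hsub]
  · have hW : X ∩ Y = Y := hWin.eq_of_cut_eq hY h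
    have hsub : Y ⊆ X := Set.inter_eq_right.1 hW
    have := Set.eq_of_subset_of_ncard_le hsub hXY
    rw [hZe, this, symmDiff_self] at hZne
    exact absurd hZne Set.not_nonempty_empty
  · have hW : X ∩ Y = Z := hWin.eq_of_cut_eq hZ h
    obtain ⟨v, hv⟩ := hZne
    have h1 := hv
    rw [← hW] at h1
    rw [hZe, Set.mem_symmDiff] at hv
    have := h1.1
    have := h1.2
    tauto

theorem ncard_commonAdjFaces_le (hc : c.signedGraph.IsCoveredByTightCuts) (l : c.Links F₁ F₂) :
    (c.commonAdjFaces F₁ F₂).ncard ≤ 3 := by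
  classical
  by_contra hlt
  set N := c.commonAdjFaces F₁ F₂ with hN
  have hregion : ∀ H H', ∃ X, H ∈ N → H' ∈ N → H ≠ H' →
      c.IsInner X ∧ c.map.graph.cut X = l.quad H H' := by
    intro H H'
    by_cases h : H ∈ N ∧ H' ∈ N ∧ H ≠ H'
    · obtain ⟨X, hX⟩ := l.exists_region h.1 h.2.1 h.2.2
      exact ⟨X, fun _ _ _ => hX⟩
    · exact ⟨∅, fun h1 h2 h3 => absurd ⟨h1, h2, h3⟩ h⟩
  choose R hR using hregion
  -- A largest region plays the role of the outermost pair; every other common neighbour splits it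
  -- in two.
  obtain ⟨⟨H, H'⟩, ⟨hH, hH', hne⟩, hmax⟩ := Set.exists_max_image N.offDiag
    (fun x => (R x.1 x.2).ncard) (Set.toFinite _) (by
      obtain ⟨a, b, ha, hb, hab⟩ := (Set.one_lt_ncard_iff (Set.toFinite N)).1 (by omega)
      exact ⟨(a, b), ha, hb, hab⟩)
  simp only at hH hH' hne hmax
  obtain ⟨hY, hYc⟩ := hR H H' hH hH' hne
  have hsplit : ∀ L ∈ N, L ≠ H → L ≠ H' →
      R H L ⊆ R H H' ∧ R L H' = R H H' \ R H L := by
    intro L hL h1 h2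
    obtain ⟨hX, hXc⟩ := hR H L hH hL h1.symm
    obtain ⟨hZ, hZc⟩ := hR L H' hL hH' h2
    exact region_subset hH hL hH' h1.symm hne h2 hX hXc hY hYc hZ hZc
      (hmax (H, L) ⟨hH, hL, h1.symm⟩) (hmax (L, H') ⟨hL, hH', h2⟩)
  have hnot : ∀ {A B L}, A ∈ N → B ∈ N → L ∈ N → L ≠ A → L ≠ B → A ≠ B → ∀ d,
      c.map.faceOf d = L → c.map.edgeOf d ∉ c.map.graph.cut (R A B) := by
    intro A B L hA hB hL h1 h2 h3 d hd he
    rw [(hR A B hA hB h3).2] at he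
    rcases faceOf_eq_of_mem_quad hA hB he with h | h | h | h <;> rw [hd] at h
    · exact hL.2.1.1 h
    · exact hL.2.2.1 h
    · exact h1 h
    · exact h2 h
  have hcross : ∀ {A B}, A ∈ N → B ∈ N → A ≠ B → ∀ K, K = A ∨ K = B →
      c.map.edgeOf (c.map.rev (l.fst K)) ∈ c.map.graph.cut (R A B) := by
    rintro A B hA hB hAB K hK
    rw [(hR A B hA hB hAB).2, CombMap.edgeOf_rev]
    rcases hK with rfl | rfl <;> simp [quad, edgeFst]
  -- The edge between `F₁` and `L` crosses the smaller region `R H L` but not `R H H'`, so it lies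
  -- in the latter, and the boundary of `L` never leaves it.
  have hface : ∀ {L}, L ∈ N → L ≠ H → L ≠ H' → ∀ d, c.map.faceOf d = L →
      c.map.vertexOf d ∈ R H H' := by
    intro L hL h1 h2 d hd
    rw [CombMap.vertexOf_mem_iff_of_faceOf_eq (hnot hH hH' hL h1 h2 hne) hd
      (l.faceOf_rev_fst L hL)]
    exact CombMap.vertexOf_mem_of_mem_cut (hsplit L hL h1 h2).1
      (hcross hH hL h1.symm L (.inr rfl))
      (hnot hH hH' hL h1 h2 hne _ (l.faceOf_rev_fst L hL))
  have hthird : ∀ {L L'}, L ∈ N → L' ∈ N → L ≠ H → L ≠ H' → L' ≠ H → L' ≠ H' → L ≠ L' →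
      c.map.faceOf (c.map.rot (c.map.rot (l.fst L))) = F₂ := by
    intro L L' hL hL' h1 h2 h3 h4 h5
    obtain ⟨hs, hs'⟩ := hsplit L' hL' h3 h4
    have hrev := l.faceOf_rev_fst L hL
    refine hY.faceOf_rot_rot_eq hc hne ?_ ?_ ?_ ?_ (l.faceOf_fst L hL) ?_ ?_ ?_ ?_
    · rw [hYc]
      refine (Set.ncard_insert_le _ _).trans (Nat.succ_le_succ ?_)
      refine (Set.ncard_insert_le _ _).trans (Nat.succ_le_succ ?_)
      exact (Set.ncard_insert_le _ _).trans (by rw [Set.ncard_singleton])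
    · intro e he
      rw [hYc] at he
      simp only [quad, Set.mem_insert_iff, Set.mem_singleton_iff] at he
      rcases he with rfl | rfl | rfl | rfl
      · simp [incidence_edgeFst hH, hH.2.1.1.symm, hH'.2.1.1.symm, hne]
      · simp [incidence_edgeSnd hH, hH.2.2.1.symm, hH'.2.2.1.symm, hne]
      · simp [incidence_edgeFst hH', hH.2.1.1.symm, hH'.2.1.1.symm, hne.symm]
      · simp [incidence_edgeSnd hH', hH.2.2.1.symm, hH'.2.2.1.symm, hne.symm]
    · intro d hd
      rw [hYc] at hd
      exact faceOf_eq_of_mem_quad hH hH' hd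
    · rw [← CombMap.vertexOf_rot]
      exact hface hL h1 h2 _ ((c.map.faceOf_rot _).trans hrev)
    · rw [hrev]
      exact hL.2.2.1
    · rwa [hrev]
    · rwa [hrev]
    · rw [hrev]
      -- Suppose `L` touches both `H` (at `a`) and `H'` (at `b`). The boundary of `H` misses `R L'
      -- H'` and that of `H'` misses `R H L'`. Hence `a` starts in `R H L'` and `b` does not,
      -- although the boundary of `L` does not cross the cut of `R H L'`.
      rintro ⟨⟨-, a, ha, ha'⟩, -, b, hb, hb'⟩
      have hYa := hface hL h1 h2 a ha
      have i1 := CombMap.vertexOf_mem_iff_of_faceOf_eq (hnot hH hL' hH' hne.symm h4.symm h3.symm)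
        ((c.map.faceOf_rot b).trans hb') (l.faceOf_rev_fst H' hH')
      have i2 := CombMap.vertexOf_mem_iff_of_faceOf_eq (hnot hL' hH' hH h3.symm hne h4)
        ((c.map.faceOf_rot a).trans ha') (l.faceOf_rev_fst H hH)
      have i3 := CombMap.vertexOf_mem_iff_of_faceOf_eq (hnot hH hL' hL h1 h5 h3.symm) ha hb
      rw [CombMap.vertexOf_rot] at i1 i2
      have hb'' : c.map.vertexOf b ∉ R H L' := by
        rw [i1]
        exact CombMap.vertexOf_notMem_of_mem_cut hs (hcross hH hH' hne H' (.inr rfl))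
          (hnot hH hL' hH' hne.symm h4.symm h3.symm _ (l.faceOf_rev_fst H' hH'))
      have ha'' : c.map.vertexOf a ∉ R L' H' := by
        rw [i2]
        exact CombMap.vertexOf_notMem_of_mem_cut (hs' ▸ Set.sdiff_subset)
          (hcross hH hH' hne H (.inl rfl))
          (hnot hL' hH' hH h3.symm hne h4 _ (l.faceOf_rev_fst H hH))
      rw [hs'] at ha''
      exact ha'' ⟨hYa, fun h => hb'' (i3.1 h)⟩
  -- With at least four common neighbours, two remain besides `H` and `H'`.
  obtain ⟨L, L', hL, hL', hLL⟩ := (Set.one_lt_ncard_iff (Set.toFinite (N \ {H, H'}))).1 (by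
    have := Set.le_ncard_sdiff {H, H'} N (Set.toFinite _)
    rw [Set.ncard_pair hne] at this
    omega)
  simp only [Set.mem_sdiff, Set.mem_insert_iff, Set.mem_singleton_iff, not_or] at hL hL'
  obtain ⟨hL, h1, h2⟩ := hL
  obtain ⟨hL', h3, h4⟩ := hL'
  have k1 := hthird hL hL' h1 h2 h3 h4 hLL
  have k2 := hthird hL' hL h3 h4 h1 h2 hLL.symm
  have r : ∀ K ∈ N, c.map.faceOf (c.map.rev (c.map.rot (c.map.rot (l.fst K)))) = F₁ := by
    intro K hK
    rw [← CombMap.faceOf_rot, (c.isCubic _).2, l.faceOf_fst K hK]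
  -- For both `L` and `L'`, the dart two rotations after `fst` has `F₂` along it and `F₁` across, so
  -- the two darts coincide.
  have := dart_unique hc (by rw [k1]; exact l.ne_outer₂) (by rw [r L hL]; exact l.ne_outer₁)
     (k2.trans k1.symm)
    ((r L' hL').trans (r L hL).symm)
  have := c.map.rot.injective (c.map.rot.injective this)
  exact edgeFst_ne (l := l) hL hL' hLL (congrArg c.map.edgeOf this.symm)

end Links

end CanonicalData

theorem lemma2p12 {V E D : Type*} [Finite V] [Finite E] [Finite D]
    (k : ℕ) (hk : 4 ≤ k) (G : SignedGraph V E) (hG : G.IsPrimeCritical k)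
    (c : CanonicalEmbedding D G k) :
    (∀ F₁ F₂ : c.map.Face, F₁ ≠ F₂ → F₁ ≠ c.outer → F₂ ≠ c.outer →
      (c.commonAdjFaces F₁ F₂).ncard ≤ 3) ∧
    (∀ F₁ F₂ : c.map.Face, F₁ ≠ F₂ → c.IsBoundaryFace F₁ → c.IsBoundaryFace F₂ →
      c.HaveConsecutiveEdges F₁ F₂ → (c.commonAdjFaces F₁ F₂).ncard ≤ 1) := by
  have hc := c.iso.isCoveredByTightCuts hG.1.isCoveredByTightCuts
  refine ⟨fun F₁ F₂ hF h₁ h₂ => ?_, fun F₁ F₂ hF h₁ h₂ h => ?_⟩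
  · obtain ⟨l⟩ := CanonicalData.exists_links hF h₁ h₂
    exact l.ncard_commonAdjFaces_le hc
  · exact h.ncard_commonAdjFaces_le hc hF h₁.1 h₂.1
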